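/- Let $T$ be a finite set of types. A branching Markov chain assigns to each $q\in T$ a finitely supported probability distribution $p(q)$ on the set $T^*$ of finite lists over $T$ and a cost $c(q)>0$. A configuration is a list of entities (elements of $T$); expanding an entity of type $q$ costs $c(q)$ and replaces it, in place, by a list drawn from $p(q)$; the empty configuration is never left and incurs no cost. A strategy chooses, possibly at random and depending on the past, one of the present entities to expand next. Let $c^*(q)\in[0,\infty]$ be the infimum over all strategies of the expected total cost (the limit of the $N$-step expected total costs) when starting from a single entity of type $q$. Assume that $c^*(q)<\infty$ for all $q\in T$. Let $\lambda_i\in[0,1]$ $(i\ge 0)$ be learning rates with $\sum_{i=0}^\infty\lambda_i=\infty$ and $\sum_{i=0}^\infty\lambda_i^2<\infty$, and let $p_{\min}>0$. In step $i$ of Q-learning a random type $q_i\in T$ is selected for update, where, conditionally on the information $\mathcal F_i$ available before step $i$ (which determines the earlier selections and observations), each type is selected with probability at least $p_{\min}$ (in particular, the selections may be independent of the past); then a list $\beta^{(i)}\in T^*$ is observed, whose law conditionally on $\mathcal F_i$ and on $q_i=q$ is $p(q)$. Starting from $Q_0\in\mathbb R^T$, the Q-values are updated by $$Q_{i+1}(q_i)=(1-\lambda_i)Q_i(q_i)+\lambda_i\Big(c(q_i)+\sum_{j=1}^{|\beta^{(i)}|}Q_i(\beta^{(i)}_j)\Big),\qquad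 Q_{i+1}(q)=Q_i(q)\ \text{ for } q\ne q_i .$$ Then for every starting vector $Q_0\ge 0$, $\lim_{i\to\infty}Q_i=c^*$ almost surely. Moreover, the target operator $T(Q)(q)=c(q)+\sum_{\alpha\in T^*}p(q)(\alpha)\sum_{j=1}^{|\alpha|}Q(\alpha_j)$ on $\mathbb R^T$ is the affine map $T(Q)=BQ+c$, where $B(q,q')=\sum_{\alpha\in T^*}p(q)(\alpha)\,|\{j:\alpha_j=q'\}|$ is the expected number of entities of type $q'$ spawned by an entity of type $q$, and $c^*$ is its unique fixed point in $\mathbb R^T$. -/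

import Mathlib

open Filter Topology MeasureTheory
open scoped ENNReal

noncomputable section

/-- A branching Markov chain with set of types `T`: an entity of type `q` is replaced by a finite
list of entities drawn from the finitely supported distribution `offspring q`, at the positive
cost `cost q`. (There is a single action per type, which is left implicit.) -/
structure BranchingMarkovChain (T : Type*) where
  /-- law of the list of entities spawned by an entity of a given type -/
  offspring : T → PMF (List T)
  finite_support : ∀ q, (offspring q).support.Finite
  /-- cost of expanding an entity of a given type -/
  cost : T → ℝ
  cost_pos : ∀ q, 0 < cost q

/-- Finite sequences `α⁰, (i₁, α¹), (i₂, α²), …, (iₙ, αⁿ)` of configurations (lists of entities)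
and positions (counted from `0`) of the expanded entities. -/
inductive FinPath (T : Type*) where
  /-- the sequence consisting of an initial configuration only -/
  | start (α : List T) : FinPath T
  /-- `π` prolonged by expanding the entity at position `i`, which leads to `α` -/
  | step (π : FinPath T) (i : ℕ) (α : List T) : FinPath T

/-- The last configuration of a finite path. -/
def FinPath.last {T : Type*} : FinPath T → List T
  | .start α => α
  | .step _ _ α => α

/-- A (randomised, history dependent) strategy: it chooses the position of the entity that is
expanded next. As long as entities are present, it has to choose one of them. (In the empty
configuration the choice has no effect, see `BranchingMarkovChain.expand`.) -/
structure Strategy (T : Type*) where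
  /-- the distribution of the position chosen after a finite path -/
  choose : FinPath T → PMF ℕ
  choose_lt : ∀ π, π.last ≠ [] → ∀ i ∈ (choose π).support, i < π.last.length

namespace BranchingMarkovChain

variable {T : Type*} (M : BranchingMarkovChain T)

/-- Law of the next configuration when the `i`-th entity of `α` is expanded: this entity is
replaced, in place, by the list that it spawns. The empty configuration is never left. -/
def expand (α : List T) (i : ℕ) : PMF (List T) :=
  match α[i]? with
  | none => PMF.pure α
  | some q => (M.offspring q).map fun β => α.take i ++ β ++ α.drop (i + 1)

/-- Cost of expanding the `i`-th entity of `α` (nothing is paid in the empty configuration). -/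
def stepCost (α : List T) (i : ℕ) : ℝ≥0∞ :=
  match α[i]? with
  | none => 0
  | some q => ENNReal.ofReal (M.cost q)

/-- Cumulative cost of a finite path. -/
def totalCost : FinPath T → ℝ≥0∞
  | .start _ => 0
  | .step π i _ => totalCost π + M.stepCost π.last i

/-- Law of the first `N` steps of the run from the initial configuration `α` under the
strategy `σ`: the probability of a path is the product of the probabilities of the choices of `σ`
and of the transitions along it. -/
def pathLaw (σ : Strategy T) (α : List T) : ℕ → PMF (FinPath T)
  | 0 => PMF.pure (.start α)
  | N + 1 => (pathLaw σ α N).bind fun π => (σ.choose π).bind fun i =>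
      (M.expand π.last i).map fun β => FinPath.step π i β

/-- The `N`-step expected total cost. -/
def expectedCostN (σ : Strategy T) (α : List T) (N : ℕ) : ℝ≥0∞ :=
  ∑' π, M.pathLaw σ α N π * M.totalCost π

/-- The expected total cost of a strategy: the limit of the `N`-step expected total costs, which
are nondecreasing in `N` (see `tendsto_expectedCostN`). -/
def expectedCost (σ : Strategy T) (α : List T) : ℝ≥0∞ :=
  ⨆ N, M.expectedCostN σ α N

/-- The optimal expected total cost, the infimum over all strategies. -/
def optCost (α : List T) : ℝ≥0∞ :=
  ⨅ σ : Strategy T, M.expectedCost σ α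

/-- The vector `c*` of optimal expected total costs from single entities. -/
def cStar (q : T) : ℝ≥0∞ := M.optCost [q]

private theorem tsum_bind_mul {X Y : Type*} (p : PMF X) (f : X → PMF Y) (g : Y → ℝ≥0∞) :
    ∑' y, p.bind f y * g y = ∑' x, p x * ∑' y, f x y * g y := by
  simp_rw [PMF.bind_apply, ← ENNReal.tsum_mul_right, ← ENNReal.tsum_mul_left]
  rw [ENNReal.tsum_comm]
  simp_rw [mul_assoc]

private theorem le_tsum_bind_mul {X Y : Type*} (p : PMF X) (f : X → PMF Y) (g : Y → ℝ≥0∞)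
    (a : ℝ≥0∞) (h : ∀ x, a ≤ ∑' y, f x y * g y) : a ≤ ∑' y, p.bind f y * g y := by
  rw [tsum_bind_mul]
  calc a = ∑' x, p x * a := by rw [ENNReal.tsum_mul_right, p.tsum_coe, one_mul]
    _ ≤ _ := ENNReal.tsum_le_tsum fun x => by gcongr; exact h x

theorem tendsto_expectedCostN (σ : Strategy T) (α : List T) :
    Tendsto (M.expectedCostN σ α) atTop (𝓝 (M.expectedCost σ α)) := by
  refine tendsto_atTop_iSup (monotone_nat_of_le_succ fun N => ?_)
  unfold expectedCostN
  rw [pathLaw, tsum_bind_mul]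
  refine ENNReal.tsum_le_tsum fun π => ?_
  gcongr
  refine le_tsum_bind_mul _ _ _ _ fun i => ?_
  refine le_tsum_bind_mul _ _ _ _ fun β => ?_
  rw [Function.comp_apply, tsum_eq_single (FinPath.step π i β)]
  · simp [totalCost]
  · intro π' h
    simp [PMF.pure_apply, h]

/-- The target operator
`T(Q)(q) = c(q) + ∑_α p(q)(α) ∑_{i ≤ |α|} Q(α_i)`
(the sum over `α` has finitely many nonzero terms). -/
def target (Q : T → ℝ) (q : T) : ℝ :=
  M.cost q + ∑' α : List T, (M.offspring q α).toReal * (α.map Q).sum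

/-- The matrix `B` of the expected numbers of entities of type `q'` spawned by one entity of
type `q`. -/
def meanMatrix [DecidableEq T] : Matrix T T ℝ :=
  Matrix.of fun q q' => ∑' α : List T, (M.offspring q α).toReal * (α.count q' : ℝ)

/-- The Q-values computed by Q-learning with learning rates `lam`, starting from `Q₀`, when the
`i`-th step selects the type `sel i` for update and observes the list `spawn i` of spawned
entities; all other Q-values are left unchanged. -/
def qValues [DecidableEq T] (lam : ℕ → ℝ) (Q₀ : T → ℝ) (sel : ℕ → T) (spawn : ℕ → List T) :
    ℕ → T → ℝ
  | 0 => Q₀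
  | i + 1 =>
    let Q := qValues lam Q₀ sel spawn i
    Function.update Q (sel i)
      ((1 - lam i) * Q (sel i) + lam i * (M.cost (sel i) + ((spawn i).map Q).sum))

/-- `sel i` and `spawn i` are the type selected for update and the offspring observed in step `i`
of a learning process, where `ℱ i` is the information available before step `i`:
conditionally on `ℱ i`, each type is selected with probability at least `pmin`, and, conditionally
on `ℱ i` and on `q` being selected, the offspring has law `offspring q`.
(The case where the selections are independent of the past is included.) -/
structure IsLearningSample {Ω : Type*} {mΩ : MeasurableSpace Ω} (μ : Measure Ω)
    (ℱ : Filtration ℕ mΩ) (pmin : ℝ) (sel : ℕ → Ω → T) (spawn : ℕ → Ω → List T) : Prop where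
  measurable_sel : ∀ i q, MeasurableSet[ℱ (i + 1)] {ω | sel i ω = q}
  measurable_spawn : ∀ i β, MeasurableSet[ℱ (i + 1)] {ω | spawn i ω = β}
  le_measure_sel : ∀ i q A, MeasurableSet[ℱ i] A →
    ENNReal.ofReal pmin * μ A ≤ μ (A ∩ {ω | sel i ω = q})
  measure_spawn : ∀ i q β A, MeasurableSet[ℱ i] A →
    μ (A ∩ {ω | sel i ω = q} ∩ {ω | spawn i ω = β}) =
      μ (A ∩ {ω | sel i ω = q}) * M.offspring q β

end BranchingMarkovChain

end

/-! The order of expansion is irrelevant: under every strategy, a single entity of type `q` incurs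
the expected cost `treeCost q` of its whole family tree. Cost paid plus tree costs of the entities
present is a martingale, which bounds the expected cost from above. For the reverse bound only `n`
generations are counted, which leaves an error at most a constant times the probability that
entities survive `N` steps; as each step costs at least `a > 0`, this probability is `O(1/N)` when
the expected cost is finite. Hence `cStar = treeCost`, and first-step analysis makes it a fixed
point `v` of the target operator.

Since `v` is finite and costs are positive, `B v = v - c ≤ γ v` for some `γ < 1`. So `B` contracts
the maximum norm weighted by `v`, which gives uniqueness.

For convergence, the weighted maximum norm is replaced by the smooth function `V(Q) = ∑ ((Q q - v q)
/ v q) ^ p` with `p` even and large. Sampling noise then averages out to first order and costs only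
`O(λ²(1 + V))`, so no a priori bound on the Q-values is needed. To first order only the selected
coordinate decays, but each is selected with probability at least `pmin`, and a large `p` makes the
influence of the other coordinates negligible (`exists_offspringMean_relError_le`). Thus `E[V_{n+1}
| ℱ n] ≤ (1 - ε λ_n + K λ_n²) V_n + K λ_n²`, and a Robbins–Siegmund argument
(`ae_tendsto_zero_of_setIntegral_le`) yields `V_n → 0` almost surely. -/

namespace PMF

/-! ### Expectations under discrete distributions -/

variable {X Y : Type*}

theorem tsum_bind_mul_eq (p : PMF X) (f : X → PMF Y) (g : Y → ℝ≥0∞) :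
    ∑' y, p.bind f y * g y = ∑' x, p x * ∑' y, f x y * g y := by
  simp_rw [PMF.bind_apply, ← ENNReal.tsum_mul_right, ← ENNReal.tsum_mul_left]
  rw [ENNReal.tsum_comm]
  simp_rw [mul_assoc]

theorem tsum_pure_mul_eq (x : X) (g : X → ℝ≥0∞) : ∑' y, PMF.pure x y * g y = g x := by
  rw [tsum_eq_single x]
  · simp
  · intro y h
    simp [PMF.pure_apply, h]

theorem tsum_map_mul_eq (p : PMF X) (f : X → Y) (g : Y → ℝ≥0∞) :
    ∑' y, p.map f y * g y = ∑' x, p x * g (f x) := by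
  rw [← PMF.bind_pure_comp, tsum_bind_mul_eq]
  simp_rw [Function.comp_apply, tsum_pure_mul_eq]

theorem tsum_mul_const (p : PMF X) (a : ℝ≥0∞) : ∑' x, p x * a = a := by
  rw [ENNReal.tsum_mul_right, p.tsum_coe, one_mul]

theorem tsum_mul_mono (p : PMF X) {f g : X → ℝ≥0∞} (h : ∀ x ∈ p.support, f x ≤ g x) :
    ∑' x, p x * f x ≤ ∑' x, p x * g x := by
  refine ENNReal.tsum_le_tsum fun x => ?_
  by_cases hx : x ∈ p.support
  · gcongr
    exact h x hx
  · simp [(p.apply_eq_zero_iff x).2 hx]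

theorem le_tsum_mul (p : PMF X) {f : X → ℝ≥0∞} {a : ℝ≥0∞} (h : ∀ x ∈ p.support, a ≤ f x) :
    a ≤ ∑' x, p x * f x :=
  (p.tsum_mul_const a).symm.le.trans (p.tsum_mul_mono h)

theorem tsum_mul_le (p : PMF X) {f : X → ℝ≥0∞} {a : ℝ≥0∞} (h : ∀ x ∈ p.support, f x ≤ a) :
    ∑' x, p x * f x ≤ a :=
  (p.tsum_mul_mono h).trans (p.tsum_mul_const a).le

theorem tsum_mul_const_add (p : PMF X) (a : ℝ≥0∞) (f : X → ℝ≥0∞) :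
    ∑' x, p x * (a + f x) = a + ∑' x, p x * f x := by
  simp_rw [mul_add]
  rw [ENNReal.tsum_add, tsum_mul_const]

end PMF

/-! ### The cost of the family tree as an upper bound -/

@[simp]
theorem FinPath.last_step {T : Type*} (π : FinPath T) (i : ℕ) (α : List T) :
    (FinPath.step π i α).last = α := rfl

namespace BranchingMarkovChain

variable {T : Type*} (M : BranchingMarkovChain T)

theorem tsum_expand_mul (l₁ l₂ : List T) (q : T) (f : List T → ℝ≥0∞) :
    ∑' β, M.expand (l₁ ++ q :: l₂) l₁.length β * f β =
      ∑' β, M.offspring q β * f (l₁ ++ β ++ l₂) := by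
  have h : M.expand (l₁ ++ q :: l₂) l₁.length =
      (M.offspring q).map fun β => l₁ ++ β ++ l₂ := by
    simp [expand]
  rw [h, PMF.tsum_map_mul_eq]

theorem stepCost_append_cons (l₁ l₂ : List T) (q : T) :
    M.stepCost (l₁ ++ q :: l₂) l₁.length = ENNReal.ofReal (M.cost q) := by
  simp [stepCost]

theorem tsum_expand_nil_mul (i : ℕ) (f : List T → ℝ≥0∞) :
    ∑' β, M.expand [] i β * f β = f [] := by
  have h : M.expand [] i = PMF.pure [] := by simp [expand]
  rw [h, PMF.tsum_pure_mul_eq]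

/-- Expected value of a function of the path after one further step. -/
noncomputable def nextExp (σ : Strategy T) (f : FinPath T → ℝ≥0∞) (π : FinPath T) : ℝ≥0∞ :=
  ∑' i, σ.choose π i * ∑' β, M.expand π.last i β * f (.step π i β)

/-- The path law appends steps at the end, whereas iterates of `nextExp` can be evaluated at any
path and unfolded at the first step as well; the inductions on `N` below rely on this. -/
theorem tsum_pathLaw_mul (σ : Strategy T) (α : List T) (N : ℕ) (f : FinPath T → ℝ≥0∞) :
    ∑' π, M.pathLaw σ α N π * f π = (M.nextExp σ)^[N] f (.start α) := by
  induction N generalizing f with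
  | zero => rw [pathLaw, PMF.tsum_pure_mul_eq]; rfl
  | succ N ih =>
    rw [pathLaw, PMF.tsum_bind_mul_eq, Function.iterate_succ_apply, ← ih]
    simp_rw [PMF.tsum_bind_mul_eq, PMF.tsum_map_mul_eq]
    rfl

theorem nextExp_mono (σ : Strategy T) : Monotone (M.nextExp σ) := by
  intro f g h π
  unfold nextExp
  gcongr
  exact h _

theorem nextExp_iterate_mono (σ : Strategy T) (N : ℕ) : Monotone (M.nextExp σ)^[N] :=
  (M.nextExp_mono σ).iterate N

theorem nextExp_add (σ : Strategy T) (f g : FinPath T → ℝ≥0∞) :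
    M.nextExp σ (f + g) = M.nextExp σ f + M.nextExp σ g := by
  funext π
  simp only [nextExp, Pi.add_apply, mul_add, ENNReal.tsum_add]

theorem nextExp_const_smul (σ : Strategy T) (a : ℝ≥0∞) (f : FinPath T → ℝ≥0∞) :
    M.nextExp σ (a • f) = a • M.nextExp σ f := by
  funext π
  simp only [nextExp, Pi.smul_apply, smul_eq_mul, ← ENNReal.tsum_mul_left]
  refine tsum_congr fun i => tsum_congr fun β => ?_
  ring

theorem nextExp_iterate_add_smul (σ : Strategy T) (N : ℕ) (a : ℝ≥0∞) (f g : FinPath T → ℝ≥0∞) :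
    (M.nextExp σ)^[N] (f + a • g) = (M.nextExp σ)^[N] f + a • (M.nextExp σ)^[N] g := by
  induction N generalizing f g with
  | zero => rfl
  | succ N ih =>
    simp only [Function.iterate_succ_apply]
    rw [nextExp_add, nextExp_const_smul, ih]

/-- The expected cost of the first `n` generations spawned by an entity. -/
noncomputable def genCost : ℕ → T → ℝ≥0∞
  | 0 => 0
  | n + 1 => fun q =>
    ENNReal.ofReal (M.cost q) + ∑' β, M.offspring q β * (β.map (genCost n)).sum

/-- The expected cost of expanding an entity and all its descendants. -/
noncomputable def treeCost (q : T) : ℝ≥0∞ := ⨆ n, M.genCost n q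

theorem _root_.List.sum_map_le_sum_map_of_le {X : Type*} (l : List X) {f g : X → ℝ≥0∞}
    (h : ∀ x, f x ≤ g x) : (l.map f).sum ≤ (l.map g).sum := by
  induction l with
  | nil => simp
  | cons a l ih => simpa using add_le_add (h a) ih

theorem genCost_mono (q : T) : Monotone fun n => M.genCost n q := by
  refine monotone_nat_of_le_succ fun n => ?_
  induction n generalizing q with
  | zero => simp [genCost]
  | succ n ih =>
    simp only [genCost] at ih ⊢
    gcongr
    exact List.sum_map_le_sum_map_of_le _ ih

theorem tendsto_genCost (q : T) : Tendsto (fun n => M.genCost n q) atTop (𝓝 (M.treeCost q)) :=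
  tendsto_atTop_iSup (M.genCost_mono q)

theorem tsum_offspring_mul (q : T) (f : List T → ℝ≥0∞) :
    ∑' β, M.offspring q β * f β =
      ∑ β ∈ (M.finite_support q).toFinset, M.offspring q β * f β := by
  refine tsum_eq_sum fun β hβ => ?_
  have : M.offspring q β = 0 := by simpa [PMF.mem_support_iff] using hβ
  simp [this]

theorem _root_.List.tendsto_sum_map {X : Type*} (l : List X) {f : ℕ → X → ℝ≥0∞} {g : X → ℝ≥0∞}
    (h : ∀ x, Tendsto (fun n => f n x) atTop (𝓝 (g x))) :
    Tendsto (fun n => (l.map (f n)).sum) atTop (𝓝 (l.map g).sum) := by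
  induction l with
  | nil => simp
  | cons a l ih => simpa using (h a).add ih

/-- Limit of the recursion for `genCost`; finite support lets the limit pass through the
expectation. -/
theorem treeCost_eq (q : T) :
    M.treeCost q = ENNReal.ofReal (M.cost q) +
      ∑' β, M.offspring q β * (β.map M.treeCost).sum := by
  refine tendsto_nhds_unique ((M.tendsto_genCost q).comp (tendsto_add_atTop_nat 1)) ?_
  simp only [Function.comp_def, genCost, tsum_offspring_mul]
  refine tendsto_const_nhds.add (tendsto_finsetSum _ fun β _ => ?_)
  refine ENNReal.Tendsto.const_mul (List.tendsto_sum_map _ M.tendsto_genCost) (Or.inr ?_)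
  exact (M.offspring q).apply_ne_top β

theorem exists_append_cons_of_lt {X : Type*} {l : List X} {i : ℕ} (h : i < l.length) :
    ∃ l₁ a l₂, l = l₁ ++ a :: l₂ ∧ l₁.length = i := by
  refine ⟨l.take i, l[i], l.drop (i + 1), by simp, by simp; omega⟩

/-- By `treeCost_eq`, an expansion trades the tree cost of the entity for its payment plus the
expected tree costs of its children, wherever the entity stands in the list. -/
theorem nextExp_totalCost_add_treeCost_le (σ : Strategy T) :
    M.nextExp σ (fun π => M.totalCost π + (π.last.map M.treeCost).sum) ≤
      fun π => M.totalCost π + (π.last.map M.treeCost).sum := by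
  intro π
  refine PMF.tsum_mul_le _ fun i hi => ?_
  by_cases h0 : π.last = []
  · rw [h0, tsum_expand_nil_mul]
    simp [totalCost, h0, stepCost]
  obtain ⟨l₁, q, l₂, hl, rfl⟩ := exists_append_cons_of_lt (σ.choose_lt π h0 i hi)
  rw [hl, tsum_expand_mul]
  simp only [totalCost, FinPath.last_step, hl, stepCost_append_cons]
  have : ∀ β : List T, M.totalCost π + ENNReal.ofReal (M.cost q) +
      ((l₁ ++ β ++ l₂).map M.treeCost).sum =
      (M.totalCost π + ENNReal.ofReal (M.cost q) + (l₁.map M.treeCost).sum +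
        (l₂.map M.treeCost).sum) + (β.map M.treeCost).sum := by
    intro β
    simp only [List.map_append, List.sum_append]
    ring
  simp_rw [this]
  rw [PMF.tsum_mul_const_add]
  simp only [List.map_append, List.sum_append, List.map_cons, List.sum_cons]
  rw [M.treeCost_eq q]
  apply le_of_eq
  ring

theorem expectedCost_le_treeCost (σ : Strategy T) (α : List T) :
    M.expectedCost σ α ≤ (α.map M.treeCost).sum := by
  refine iSup_le fun N => ?_
  rw [expectedCostN, tsum_pathLaw_mul]
  have key : (M.nextExp σ)^[N] (fun π => M.totalCost π + (π.last.map M.treeCost).sum) ≤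
      fun π => M.totalCost π + (π.last.map M.treeCost).sum := by
    induction N with
    | zero => exact le_rfl
    | succ N ih =>
      rw [Function.iterate_succ_apply]
      exact (M.nextExp_iterate_mono σ N (M.nextExp_totalCost_add_treeCost_le σ)).trans ih
  refine (M.nextExp_iterate_mono σ N (fun π => le_self_add) _).trans ((key _).trans ?_)
  simp [totalCost, FinPath.last]

/-- The strategy that always expands the first entity. -/
noncomputable def firstStrategy (T : Type*) : Strategy T where
  choose _ := PMF.pure 0
  choose_lt π h i hi := by
    have : i = 0 := by simpa using hi
    rw [this]
    exact List.length_pos_of_ne_nil h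

theorem cStar_le_treeCost (q : T) : M.cStar q ≤ M.treeCost q :=
  (iInf_le _ (firstStrategy T)).trans (by simpa using M.expectedCost_le_treeCost (firstStrategy T) [q])

/-! ### Lower bound for every strategy -/

/-- Indicator that entities are left at the end of a path. -/
noncomputable def alive (π : FinPath T) : ℝ≥0∞ := if π.last = [] then 0 else 1

theorem nextExp_iterate_alive_le_one (σ : Strategy T) (N : ℕ) (π : FinPath T) :
    (M.nextExp σ)^[N] alive π ≤ 1 := by
  induction N generalizing π with
  | zero => simp only [Function.iterate_zero, id, alive]; split_ifs <;> simp
  | succ N ih =>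
    rw [Function.iterate_succ_apply']
    exact PMF.tsum_mul_le _ fun i _ => PMF.tsum_mul_le _ fun β _ => ih _

theorem nextExp_iterate_alive_eq_zero (σ : Strategy T) (N : ℕ) (π : FinPath T)
    (h : π.last = []) : (M.nextExp σ)^[N] alive π = 0 := by
  induction N generalizing π with
  | zero => simp [alive, h]
  | succ N ih =>
    rw [Function.iterate_succ_apply', ← nonpos_iff_eq_zero]
    refine PMF.tsum_mul_le _ fun i _ => ?_
    rw [h, tsum_expand_nil_mul, ih _ rfl]

theorem totalCost_le_nextExp (σ : Strategy T) : M.totalCost ≤ M.nextExp σ M.totalCost :=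
  fun _ => PMF.le_tsum_mul _ fun _ _ => PMF.le_tsum_mul _ fun _ _ => le_self_add

theorem totalCost_le_nextExp_iterate (σ : Strategy T) (N : ℕ) :
    M.totalCost ≤ (M.nextExp σ)^[N] M.totalCost := by
  induction N with
  | zero => exact le_rfl
  | succ N ih =>
    rw [Function.iterate_succ_apply]
    exact ih.trans (M.nextExp_iterate_mono σ N (M.totalCost_le_nextExp σ))

/-- A run still alive after `N` steps has paid at least `a` in each of them. With finite expected
cost, this forces the survival probability to be `O(1/N)`. -/
theorem totalCost_add_alive_le (σ : Strategy T) {a : ℝ≥0∞}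
    (ha : ∀ q, a ≤ ENNReal.ofReal (M.cost q)) (N : ℕ) (π : FinPath T) :
    M.totalCost π + N * a * (M.nextExp σ)^[N] alive π ≤ (M.nextExp σ)^[N] M.totalCost π := by
  induction N generalizing π with
  | zero => simp
  | succ N ih =>
    by_cases h0 : π.last = []
    · rw [nextExp_iterate_alive_eq_zero _ _ _ _ h0, mul_zero, add_zero]
      exact M.totalCost_le_nextExp_iterate σ _ π
    have h1 : M.totalCost π + a + N * a * (M.nextExp σ)^[N + 1] alive π ≤
        (M.nextExp σ)^[N + 1] M.totalCost π := by
      rw [Function.iterate_succ_apply', Function.iterate_succ_apply']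
      calc M.totalCost π + a + N * a * M.nextExp σ ((M.nextExp σ)^[N] alive) π
          = M.nextExp σ ((fun _ => M.totalCost π + a) +
              (N * a) • ((M.nextExp σ)^[N] alive)) π := by
            rw [nextExp_add, nextExp_const_smul]
            simp only [Pi.add_apply, Pi.smul_apply, smul_eq_mul]
            congr 1
            simp only [nextExp, PMF.tsum_mul_const]
        _ ≤ _ := by
            refine PMF.tsum_mul_mono _ fun i hi => PMF.tsum_mul_mono _ fun β _ => ?_
            refine le_trans ?_ (ih _)
            simp only [Pi.add_apply, Pi.smul_apply, smul_eq_mul, totalCost]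
            gcongr
            obtain ⟨l₁, q, l₂, hl, rfl⟩ := exists_append_cons_of_lt (σ.choose_lt π h0 i hi)
            rw [hl, stepCost_append_cons]
            exact ha q
    refine le_trans ?_ h1
    have h2 := M.nextExp_iterate_alive_le_one σ (N + 1) π
    rw [add_assoc]
    gcongr
    push_cast
    rw [add_mul, add_mul, one_mul, add_comm]
    gcongr
    exact mul_le_of_le_one_right' h2

/-- A deterministic bound on the cost that can be caused by an entity within `n` generations, when
expansions cost at most `c` and spawn at most `L` entities. -/
noncomputable def genBound (c L : ℝ≥0∞) : ℕ → ℝ≥0∞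
  | 0 => 0
  | n + 1 => c + L * genBound c L n

theorem genBound_ne_top {c L : ℝ≥0∞} (hc : c ≠ ∞) (hL : L ≠ ∞) (n : ℕ) : genBound c L n ≠ ∞ := by
  induction n with
  | zero => simp [genBound]
  | succ n ih => exact ENNReal.add_ne_top.2 ⟨hc, ENNReal.mul_ne_top hL ih⟩

theorem _root_.List.sum_map_le_length_mul {X : Type*} (l : List X) {f : X → ℝ≥0∞} {a : ℝ≥0∞}
    (h : ∀ x, f x ≤ a) : (l.map f).sum ≤ l.length * a := by
  induction l with
  | nil => simp
  | cons x l ih =>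
    simp only [List.map_cons, List.sum_cons, List.length_cons, Nat.cast_add, Nat.cast_one]
    rw [add_mul, one_mul, add_comm]
    exact add_le_add ih (h x)

theorem genCost_le_genBound {c : ℝ≥0∞} {L : ℕ} (hc : ∀ q, ENNReal.ofReal (M.cost q) ≤ c)
    (hL : ∀ q, ∀ β ∈ (M.offspring q).support, β.length ≤ L) (n : ℕ) (q : T) :
    M.genCost n q ≤ genBound c L n := by
  induction n generalizing q with
  | zero => simp [genCost]
  | succ n ih =>
    refine add_le_add (hc q) (PMF.tsum_mul_le _ fun β hβ => ?_)
    refine (List.sum_map_le_length_mul β ih).trans ?_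
    gcongr
    exact_mod_cast hL q β hβ

/-- If the entities present are labelled with numbers of generations, the cost of the expansions
within these generations is a lower bound on the final cost, up to what is still to be expanded. -/
theorem totalCost_add_genCost_le (σ : Strategy T) {c : ℝ≥0∞} {L : ℕ}
    (hc : ∀ q, ENNReal.ofReal (M.cost q) ≤ c)
    (hL : ∀ q, ∀ β ∈ (M.offspring q).support, β.length ≤ L) (K : ℝ≥0∞) (N : ℕ) (π : FinPath T)
    (C : List (T × ℕ)) (hC : C.map Prod.fst = π.last)
    (hK : (C.map fun e => genBound c L e.2).sum ≤ K) :
    M.totalCost π + (C.map fun e => M.genCost e.2 e.1).sum ≤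
      (M.nextExp σ)^[N] (M.totalCost + K • alive) π := by
  induction N generalizing π C with
  | zero =>
    simp only [Function.iterate_zero, id, Pi.add_apply, Pi.smul_apply, smul_eq_mul]
    gcongr
    by_cases h0 : π.last = []
    · have : C = [] := by simpa [h0] using hC
      simp [this]
    · rw [alive, if_neg h0, mul_one]
      exact (List.sum_map_le_sum_map_of_le _ fun e => M.genCost_le_genBound hc hL _ _).trans hK
  | succ N ih =>
    rw [Function.iterate_succ_apply']
    refine PMF.le_tsum_mul _ fun i hi => ?_
    by_cases h0 : π.last = []
    · have : C = [] := by simpa [h0] using hC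
      subst this
      rw [h0, tsum_expand_nil_mul]
      refine le_trans ?_ (ih _ [] rfl (by simp))
      simp [totalCost]
    have hi' := σ.choose_lt π h0 i hi
    rw [← hC, List.length_map] at hi'
    obtain ⟨C₁, ⟨q, k⟩, C₂, rfl, rfl⟩ := exists_append_cons_of_lt hi'
    have hl : π.last = C₁.map Prod.fst ++ q :: C₂.map Prod.fst := by simp [← hC]
    have hlen : C₁.length = (C₁.map Prod.fst).length := by simp
    rw [hl, hlen, tsum_expand_mul]
    set A := (C₁.map fun e => M.genCost e.2 e.1).sum
    set B := (C₂.map fun e => M.genCost e.2 e.1).sum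
    have hstep : ∀ β ∈ (M.offspring q).support,
        (M.totalCost π + ENNReal.ofReal (M.cost q) + A + B) + (β.map (M.genCost (k - 1))).sum ≤
        (M.nextExp σ)^[N] (M.totalCost + K • alive)
          (.step π (C₁.map Prod.fst).length (C₁.map Prod.fst ++ β ++ C₂.map Prod.fst)) := by
      intro β hβ
      -- Children inherit the label `k - 1`. Truncation at `k = 0` is harmless: beyond the horizon,
      -- entities and their descendants all keep label `0` and count for nothing.
      refine le_trans (le_of_eq ?_) (ih _ (C₁ ++ β.map (fun x => (x, k - 1)) ++ C₂) ?_ ?_)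
      · simp only [totalCost, hl, stepCost_append_cons, List.map_append, List.sum_append,
          List.map_map, Function.comp_def]
        simp only [A, B]
        ring
      · simp [FinPath.last, Function.comp_def]
      -- The budget `K` stays valid, as at most `L` children replace the bound for `k + 1` by `L`
      -- times the bound for `k`.
      · refine le_trans ?_ hK
        simp only [List.map_append, List.sum_append, List.map_map, Function.comp_def,
          List.map_cons, List.sum_cons, List.map_const', List.sum_replicate, nsmul_eq_mul]
        rw [add_assoc]
        gcongr
        cases k with
        | zero => simp [genBound]
        | succ k =>
          refine le_trans ?_ le_add_self
          rw [Nat.add_sub_cancel]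
          gcongr
          exact_mod_cast hL q β hβ
    refine le_trans ?_ (PMF.tsum_mul_mono _ hstep)
    rw [PMF.tsum_mul_const_add]
    simp only [List.map_append, List.sum_append, List.map_cons, List.sum_cons]
    cases k with
    | zero =>
      simp only [genCost, Pi.zero_apply, zero_add, Nat.zero_sub, A, B]
      refine le_trans ?_ le_self_add
      rw [← add_assoc]
      gcongr
      exact le_self_add
    | succ k =>
      rw [Nat.add_sub_cancel, genCost]
      apply le_of_eq
      simp only [A, B]
      ring

theorem exists_length_le [Finite T] :
    ∃ L : ℕ, ∀ q, ∀ β ∈ (M.offspring q).support, β.length ≤ L := by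
  have h : (⋃ q, (M.offspring q).support).Finite := Set.finite_iUnion M.finite_support
  obtain ⟨L, hL⟩ := (h.image List.length).bddAbove
  exact ⟨L, fun q β hβ => hL ⟨β, Set.mem_iUnion.2 ⟨q, hβ⟩, rfl⟩⟩

/-- Combine the two preceding estimates: the truncated cost exceeds `J` by at most `K` times the
survival probability, which is at most `J / ((N + 1) a)` and vanishes as `N → ∞`. -/
theorem genCost_le_expectedCost [Finite T] (σ : Strategy T) (q : T) (n : ℕ) :
    M.genCost n q ≤ M.expectedCost σ [q] := by
  rcases eq_or_ne (M.expectedCost σ [q]) ∞ with hJ | hJ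
  · simp [hJ]
  cases nonempty_fintype T
  have : Nonempty T := ⟨q⟩
  obtain ⟨L, hL⟩ := M.exists_length_le
  obtain ⟨qm, hqm⟩ := Finite.exists_max M.cost
  obtain ⟨qn, hqn⟩ := Finite.exists_min M.cost
  have hc : ∀ q, ENNReal.ofReal (M.cost q) ≤ ENNReal.ofReal (M.cost qm) :=
    fun q => ENNReal.ofReal_le_ofReal (hqm q)
  set a := ENNReal.ofReal (M.cost qn) with ha
  have ha0 : a ≠ 0 := by simpa [ha] using M.cost_pos qn
  have hat : a ≠ ∞ := ENNReal.ofReal_ne_top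
  set J := M.expectedCost σ [q]
  set K := genBound (ENNReal.ofReal (M.cost qm)) L n
  have hKt : K ≠ ∞ := genBound_ne_top ENNReal.ofReal_ne_top (ENNReal.natCast_ne_top L) n
  have hN : ∀ N, (M.nextExp σ)^[N] M.totalCost (.start [q]) ≤ J := fun N => by
    rw [← tsum_pathLaw_mul]
    exact le_iSup (M.expectedCostN σ [q]) N
  have key : ∀ N : ℕ, M.genCost n q ≤ J + K * (J * a⁻¹) * ((N + 1 : ℕ) : ℝ≥0∞)⁻¹ := by
    intro N
    have h1 := M.totalCost_add_genCost_le σ hc hL K (N + 1) (.start [q]) [(q, n)] rfl (by simp [K])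
    have h2 := M.totalCost_add_alive_le σ (a := a)
      (fun q => ENNReal.ofReal_le_ofReal (hqn q)) (N + 1) (.start [q])
    rw [nextExp_iterate_add_smul] at h1
    simp only [totalCost, zero_add, List.map_cons, List.map_nil, List.sum_cons, List.sum_nil,
      add_zero, Pi.add_apply, Pi.smul_apply, smul_eq_mul] at h1 h2
    refine h1.trans ?_
    rw [mul_assoc]
    gcongr
    · exact hN _
    · have h3 := h2.trans (hN _)
      have hNt : ((N + 1 : ℕ) : ℝ≥0∞) * a ≠ 0 := by simp [ha0]
      have hNt' : ((N + 1 : ℕ) : ℝ≥0∞) * a ≠ ∞ :=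
        ENNReal.mul_ne_top (ENNReal.natCast_ne_top _) hat
      rw [mul_comm, ← ENNReal.le_div_iff_mul_le (Or.inl hNt) (Or.inl hNt')] at h3
      refine h3.trans (le_of_eq ?_)
      rw [ENNReal.div_eq_inv_mul, ENNReal.mul_inv (Or.inr hat) (Or.inr ha0)]
      ring
  have hlim : Tendsto (fun N : ℕ => J + K * (J * a⁻¹) * ((N + 1 : ℕ) : ℝ≥0∞)⁻¹) atTop
      (𝓝 (J + K * (J * a⁻¹) * 0)) := by
    refine tendsto_const_nhds.add (ENNReal.Tendsto.const_mul ?_ (Or.inr ?_))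
    · exact ENNReal.tendsto_inv_nat_nhds_zero.comp (tendsto_add_atTop_nat 1)
    · exact ENNReal.mul_ne_top hKt (ENNReal.mul_ne_top hJ (ENNReal.inv_ne_top.2 ha0))
  simpa using ge_of_tendsto' hlim key

theorem cStar_eq_treeCost [Finite T] (q : T) : M.cStar q = M.treeCost q :=
  le_antisymm (M.cStar_le_treeCost q)
    (le_iInf fun σ => iSup_le fun n => M.genCost_le_expectedCost σ q n)

theorem cStar_eq [Finite T] (q : T) :
    M.cStar q = ENNReal.ofReal (M.cost q) +
      ∑' β, M.offspring q β * (β.map M.cStar).sum := by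
  have : M.cStar = M.treeCost := funext M.cStar_eq_treeCost
  rw [this]
  exact M.treeCost_eq q

end BranchingMarkovChain

/-! ### The affine target operator and its fixed point -/

namespace BranchingMarkovChain

variable {T : Type*} (M : BranchingMarkovChain T)

/-- The lists that an entity spawns with positive probability. -/
noncomputable def offspringSupport (q : T) : Finset (List T) := (M.finite_support q).toFinset

/-- The expected value of a real function of the offspring. -/
noncomputable def offspringMean (q : T) (f : List T → ℝ) : ℝ :=
  ∑ β ∈ M.offspringSupport q, (M.offspring q β).toReal * f β

theorem mem_offspringSupport {q : T} {β : List T} :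
    β ∈ M.offspringSupport q ↔ M.offspring q β ≠ 0 := by
  simp [offspringSupport, PMF.mem_support_iff]

theorem tsum_toReal_mul (q : T) (f : List T → ℝ) :
    ∑' β, (M.offspring q β).toReal * f β = M.offspringMean q f := by
  refine tsum_eq_sum fun β hβ => ?_
  have : M.offspring q β = 0 := by simpa [mem_offspringSupport] using hβ
  simp [this]

theorem offspringMean_const (q : T) (a : ℝ) : M.offspringMean q (fun _ => a) = a := by
  have h : ∑ β ∈ M.offspringSupport q, (M.offspring q β).toReal = 1 := by
    have h1 := M.tsum_offspring_mul q 1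
    simp only [Pi.one_apply, mul_one, PMF.tsum_coe] at h1
    rw [← ENNReal.toReal_sum (fun β _ => (M.offspring q).apply_ne_top β)]
    simp [offspringSupport, ← h1]
  rw [offspringMean, ← Finset.sum_mul, h, one_mul]

theorem offspringMean_add (q : T) (f g : List T → ℝ) :
    M.offspringMean q (fun β => f β + g β) = M.offspringMean q f + M.offspringMean q g := by
  simp only [offspringMean, mul_add, Finset.sum_add_distrib]

theorem offspringMean_const_mul (q : T) (a : ℝ) (f : List T → ℝ) :
    M.offspringMean q (fun β => a * f β) = a * M.offspringMean q f := by
  simp only [offspringMean, Finset.mul_sum]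
  exact Finset.sum_congr rfl fun β _ => by ring

theorem offspringMean_mono {q : T} {f g : List T → ℝ}
    (h : ∀ β ∈ M.offspringSupport q, f β ≤ g β) : M.offspringMean q f ≤ M.offspringMean q g :=
  Finset.sum_le_sum fun β hβ => mul_le_mul_of_nonneg_left (h β hβ) ENNReal.toReal_nonneg

theorem abs_offspringMean_le (q : T) (f : List T → ℝ) :
    |M.offspringMean q f| ≤ M.offspringMean q fun β => |f β| := by
  refine (Finset.abs_sum_le_sum_abs _ _).trans (le_of_eq ?_)
  simp [offspringMean, abs_mul]

theorem target_eq (Q : T → ℝ) (q : T) :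
    M.target Q q = M.cost q + M.offspringMean q fun β => (β.map Q).sum := by
  rw [target, tsum_toReal_mul]

theorem _root_.List.sum_map_eq_sum_count {X : Type*} [Fintype X] [DecidableEq X] (l : List X)
    (f : X → ℝ) : (l.map f).sum = ∑ x, (l.count x : ℝ) * f x := by
  induction l with
  | nil => simp
  | cons a l ih =>
    simp [List.count_cons, ih, add_mul, Finset.sum_add_distrib, add_comm]

theorem target_eq_mulVec_add [Fintype T] [DecidableEq T] (Q : T → ℝ) :
    M.target Q = M.meanMatrix.mulVec Q + M.cost := by
  funext q
  rw [target_eq, Pi.add_apply, add_comm]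
  congr 1
  simp only [Matrix.mulVec, dotProduct, meanMatrix, Matrix.of_apply, tsum_toReal_mul,
    offspringMean, List.sum_map_eq_sum_count, Finset.mul_sum, Finset.sum_mul]
  rw [Finset.sum_comm]
  exact Finset.sum_congr rfl fun _ _ => Finset.sum_congr rfl fun _ _ => by ring

theorem _root_.List.toReal_sum_map {X : Type*} (l : List X) {f : X → ℝ≥0∞} (h : ∀ x, f x ≠ ∞) :
    (l.map f).sum ≠ ∞ ∧ (l.map f).sum.toReal = (l.map fun x => (f x).toReal).sum := by
  induction l with
  | nil => simp
  | cons a l ih => simp [h a, ih.1, ENNReal.toReal_add (h a) ih.1, ih.2]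

theorem target_toReal_cStar [Finite T] (hfin : ∀ q, M.cStar q ≠ ∞) :
    M.target (fun q => (M.cStar q).toReal) = fun q => (M.cStar q).toReal := by
  funext q
  have hs : ∀ β ∈ (M.finite_support q).toFinset,
      M.offspring q β * (β.map M.cStar).sum ≠ ∞ := fun β _ =>
    ENNReal.mul_ne_top ((M.offspring q).apply_ne_top β) (List.toReal_sum_map β hfin).1
  rw [target_eq, M.cStar_eq q, tsum_offspring_mul,
    ENNReal.toReal_add ENNReal.ofReal_ne_top (ENNReal.sum_ne_top.2 hs),
    ENNReal.toReal_ofReal (M.cost_pos q).le, ENNReal.toReal_sum hs]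
  congr 1
  refine Finset.sum_congr rfl fun β _ => ?_
  rw [ENNReal.toReal_mul, (List.toReal_sum_map β hfin).2]

theorem _root_.List.abs_sum_map_le {X : Type*} (l : List X) {f g : X → ℝ}
    (h : ∀ x, |f x| ≤ g x) : |(l.map f).sum| ≤ (l.map g).sum := by
  induction l with
  | nil => simp
  | cons a l ih => simpa using (abs_add_le _ _).trans (add_le_add (h a) ih)

theorem _root_.List.sum_map_const_mul {X : Type*} (l : List X) (a : ℝ) (f : X → ℝ) :
    (l.map fun x => a * f x).sum = a * (l.map f).sum := by
  induction l with
  | nil => simp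
  | cons x l ih => simp [ih, mul_add]

variable {M}

/-- A positive fixed point of the target operator weights a norm for which the linear part of the
target operator is a contraction. -/
theorem abs_offspringMean_sum_le {v : T → ℝ} (hv : M.target v = v) {y : T → ℝ} {a : ℝ}
    (hy : ∀ q, |y q| ≤ a * v q) (q : T) :
    |M.offspringMean q fun β => (β.map y).sum| ≤ a * (v q - M.cost q) := by
  have h := congrFun hv q
  rw [target_eq] at h
  calc _ ≤ M.offspringMean q fun β => |(β.map y).sum| := M.abs_offspringMean_le _ _
    _ ≤ M.offspringMean q fun β => a * (β.map v).sum :=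
      M.offspringMean_mono fun β _ => by
        rw [← List.sum_map_const_mul]
        exact List.abs_sum_map_le β hy
    _ = _ := by rw [offspringMean_const_mul, ← h]; ring

/-- If `C` bounds the ratios `v / cost`, then `cost ≥ v / C`, so `γ = 1 - 1 / C` works; enlarging
`C` to at least `2` keeps `γ` inside `(0, 1)`. -/
theorem exists_contraction_factor [Finite T] (M : BranchingMarkovChain T) (v : T → ℝ) :
    ∃ γ : ℝ, 0 < γ ∧ γ < 1 ∧ ∀ q, v q - M.cost q ≤ γ * v q := by
  obtain ⟨C, hC⟩ := (Set.finite_range fun q => v q / M.cost q).bddAbove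
  have hC' : ∀ q, v q / M.cost q ≤ max C 2 := fun q => (hC ⟨q, rfl⟩).trans (le_max_left _ _)
  have h2 : (2 : ℝ) ≤ max C 2 := le_max_right _ _
  have hpos : 0 < max C 2 := by linarith
  have hinv : (max C 2)⁻¹ ≤ 2⁻¹ := inv_anti₀ (by norm_num) h2
  refine ⟨1 - (max C 2)⁻¹, by linarith, by simp, fun q => ?_⟩
  have h3 := hC' q
  rw [div_le_iff₀ (M.cost_pos q)] at h3
  have h4 : (max C 2)⁻¹ * v q ≤ M.cost q := by
    rwa [inv_mul_le_iff₀ hpos]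
  linarith

theorem target_sub (Q R : T → ℝ) (q : T) :
    M.target Q q - M.target R q =
      M.offspringMean q fun β => (β.map fun x => Q x - R x).sum := by
  have h : (fun β : List T => (β.map Q).sum) =
      fun β => (β.map fun x => Q x - R x).sum + (β.map R).sum := by
    funext β
    induction β with
    | nil => simp
    | cons a l ih => simp only [List.map_cons, List.sum_cons, ih]; ring
  rw [target_eq, target_eq, h, offspringMean_add]
  ring

/-- The difference of two fixed points is fixed by the linear part, so its weighted maximum norm `a`
satisfies `a ≤ a * γ` and vanishes. -/
theorem eq_of_target_eq [Fintype T] {v : T → ℝ} (hv0 : ∀ q, 0 < v q) (hv : M.target v = v)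
    {Q : T → ℝ} (hQ : M.target Q = Q) : Q = v := by
  obtain ⟨γ, hγ0, hγ1, hγ⟩ := exists_contraction_factor M v
  funext q₀
  have : Nonempty T := ⟨q₀⟩
  obtain ⟨qm, hqm⟩ := Finite.exists_max fun q => |Q q - v q| / v q
  set a := |Q qm - v qm| / v qm
  have ha : ∀ q, |Q q - v q| ≤ a * v q := fun q => (div_le_iff₀ (hv0 q)).1 (hqm q)
  have ha0 : 0 ≤ a := div_nonneg (abs_nonneg _) (hv0 _).le
  have h1 : |Q qm - v qm| ≤ a * (γ * v qm) := by
    have h2 := target_sub (M := M) Q v qm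
    rw [hQ, hv] at h2
    rw [h2]
    exact (abs_offspringMean_sum_le hv ha qm).trans (mul_le_mul_of_nonneg_left (hγ qm) ha0)
  have h3 : a ≤ a * γ := by
    rw [div_le_iff₀ (hv0 qm)]
    linarith
  have h4 : a = 0 := by nlinarith
  have h5 := ha q₀
  rw [h4, zero_mul] at h5
  exact sub_eq_zero.1 (abs_nonpos_iff.1 h5)

end BranchingMarkovChain

/-! ### Inequalities for powers -/

/-- The error of the first order expansion of a power. -/
theorem abs_add_mul_pow_sub_le {u h t : ℝ} (ht0 : 0 ≤ t) (ht1 : t ≤ 1) (p : ℕ) :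
    |(u + t * h) ^ p - u ^ p - p * t * u ^ (p - 1) * h| ≤ p ^ 2 * t ^ 2 * (|u| + |h|) ^ p := by
  induction p with
  | zero => simp
  | succ p ih =>
    -- The expansion errors obey a recursion in `p`; the bound closes because `p² + p ≤ (p + 1)²`.
    -- The truncated exponent at `p = 0` only occurs with coefficient `0`.
    have e : (u + t * h) ^ (p + 1) - u ^ (p + 1) - ((p + 1 : ℕ) : ℝ) * t * u ^ (p + 1 - 1) * h =
        (u + t * h) * ((u + t * h) ^ p - u ^ p - p * t * u ^ (p - 1) * h) +
          p * t ^ 2 * u ^ (p - 1) * h ^ 2 := by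
      cases p with
      | zero => simp
      | succ p => push_cast; ring_nf
    set a := |u| + |h| with ha
    have hu : |u| ≤ a := by simp [ha]
    have hh : |h| ≤ a := by simp [ha]
    have ha0 : 0 ≤ a := (abs_nonneg u).trans hu
    have h1 : |u + t * h| ≤ a := by
      refine (abs_add_le _ _).trans ?_
      rw [abs_mul, abs_of_nonneg ht0]
      have := mul_le_of_le_one_left (abs_nonneg h) ht1
      linarith
    have h2 : |(p : ℝ) * t ^ 2 * u ^ (p - 1) * h ^ 2| ≤ p * t ^ 2 * a ^ (p + 1) := by
      cases p with
      | zero => simp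
      | succ p =>
        rw [abs_mul, abs_mul, abs_mul, abs_pow, abs_pow, abs_pow, Nat.abs_cast, abs_of_nonneg ht0,
          Nat.add_sub_cancel, mul_assoc (_ * _)]
        refine mul_le_mul_of_nonneg_left ?_ (by positivity)
        calc |u| ^ p * |h| ^ 2 ≤ a ^ p * a ^ 2 := by gcongr
          _ = a ^ (p + 1 + 1) := by ring
    rw [e]
    calc _ ≤ |u + t * h| * |(u + t * h) ^ p - u ^ p - p * t * u ^ (p - 1) * h| +
          |(p : ℝ) * t ^ 2 * u ^ (p - 1) * h ^ 2| := by
            rw [← abs_mul]; exact abs_add_le _ _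
      _ ≤ a * (p ^ 2 * t ^ 2 * a ^ p) + p * t ^ 2 * a ^ (p + 1) := by gcongr
      _ = ((p : ℝ) ^ 2 + p) * t ^ 2 * a ^ (p + 1) := by ring
      _ ≤ _ := by
        gcongr
        push_cast
        nlinarith [(Nat.cast_nonneg p : (0 : ℝ) ≤ p)]

/-- A Young-type inequality, split at `s = δ b`. With `γ < δ < 1` the first coefficient is below
`1`, and the second tends to `0` as `p` grows. -/
theorem pow_mul_sub_le {s γ δ b : ℝ} (hs : 0 ≤ s) (hγ : 0 ≤ γ) (hδ : 0 < δ) (hb : 0 ≤ b) (p : ℕ) :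
    s ^ p * (γ * b) ≤ γ / δ * s ^ (p + 1) + γ * δ ^ p * b ^ (p + 1) := by
  rcases le_total (δ * b) s with h | h
  · have h1 : b ≤ s / δ := by rwa [le_div_iff₀ hδ, mul_comm]
    calc s ^ p * (γ * b) ≤ s ^ p * (γ * (s / δ)) := by gcongr
      _ = γ / δ * s ^ (p + 1) := by ring
      _ ≤ _ := le_add_of_nonneg_right (by positivity)
  · calc s ^ p * (γ * b) ≤ (δ * b) ^ p * (γ * b) := by gcongr
      _ = γ * δ ^ p * b ^ (p + 1) := by ring
      _ ≤ _ := le_add_of_nonneg_left (by positivity)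

/-! ### The Lyapunov function and its drift -/

namespace BranchingMarkovChain

variable {T : Type*} {M : BranchingMarkovChain T}

/-- A smooth substitute for the distance of `Q` and `v` in the maximum norm weighted by `v`. -/
noncomputable def relError [Fintype T] (v : T → ℝ) (p : ℕ) (Q : T → ℝ) : ℝ :=
  ∑ q, ((Q q - v q) / v q) ^ p

/-- The value computed by a step of Q-learning from the offspring `β` of `q`. -/
noncomputable def learn [DecidableEq T] (M : BranchingMarkovChain T) (t : ℝ) (Q : T → ℝ) (q : T)
    (β : List T) : T → ℝ :=
  Function.update Q q ((1 - t) * Q q + t * (M.cost q + (β.map Q).sum))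

theorem relError_nonneg [Fintype T] (v : T → ℝ) {p : ℕ} (hp : Even p) (Q : T → ℝ) :
    0 ≤ relError v p Q :=
  Finset.sum_nonneg fun _ _ => hp.pow_nonneg _

theorem pow_le_relError [Fintype T] (v : T → ℝ) {p : ℕ} (hp : Even p) (Q : T → ℝ) (q : T) :
    ((Q q - v q) / v q) ^ p ≤ relError v p Q :=
  Finset.single_le_sum (f := fun q => ((Q q - v q) / v q) ^ p)
    (fun _ _ => hp.pow_nonneg _) (Finset.mem_univ q)

theorem relError_update [Fintype T] [DecidableEq T] (v : T → ℝ) (p : ℕ) (Q : T → ℝ) (q : T)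
    (x : ℝ) : relError v p (Function.update Q q x) =
      relError v p Q + (((x - v q) / v q) ^ p - ((Q q - v q) / v q) ^ p) := by
  rw [← sub_eq_iff_eq_add', relError, relError, ← Finset.sum_sub_distrib,
    Finset.sum_eq_single q (fun r _ hr => by simp [hr]) (by simp)]
  simp

/-- Costs and offspring numbers are bounded, so increments grow at most linearly in the error. This
lets `1 + V` control the second-order term. -/
theorem exists_abs_increment_le [Finite T] (M : BranchingMarkovChain T) {v : T → ℝ}
    (hv0 : ∀ q, 0 < v q) : ∃ D : ℝ, 0 ≤ D ∧ ∀ (Q : T → ℝ) (a : ℝ), 0 ≤ a →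
      (∀ q, |(Q q - v q) / v q| ≤ a) → ∀ q, ∀ β ∈ M.offspringSupport q,
      |(Q q - v q) / v q| + |(M.cost q + (β.map Q).sum - Q q) / v q| ≤ D * (1 + a) := by
  cases nonempty_fintype T
  obtain ⟨L, hL⟩ := M.exists_length_le
  obtain ⟨C, hC⟩ := (Set.finite_range M.cost).bddAbove
  obtain ⟨U, hU⟩ := (Set.finite_range v).bddAbove
  obtain ⟨W, hW⟩ := (Set.finite_range fun q => (v q)⁻¹).bddAbove
  rcases isEmpty_or_nonempty T with hT | ⟨⟨q₀⟩⟩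
  · exact ⟨0, le_rfl, fun _ _ _ _ q => isEmptyElim q⟩
  have hC0 : 0 ≤ C := (M.cost_pos q₀).le.trans (hC ⟨q₀, rfl⟩)
  have hU0 : 0 ≤ U := (hv0 q₀).le.trans (hU ⟨q₀, rfl⟩)
  have hW0 : 0 ≤ W := (inv_pos.2 (hv0 q₀)).le.trans (hW ⟨q₀, rfl⟩)
  refine ⟨1 + (C + L * U + U) * W, by positivity, fun Q a ha h q β hβ => ?_⟩
  have hQ : ∀ q, |Q q| ≤ U * (1 + a) := by
    intro q
    have e : Q q = v q * (1 + (Q q - v q) / v q) := by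
      field_simp [(hv0 q).ne']
      ring
    rw [e, abs_mul, abs_of_pos (hv0 q)]
    refine mul_le_mul (hU ⟨q, rfl⟩) ?_ (abs_nonneg _) hU0
    refine (abs_add_le _ _).trans ?_
    rw [abs_one]
    linarith [h q]
  have hs : |(β.map Q).sum| ≤ L * (U * (1 + a)) := by
    refine (List.abs_sum_map_le β hQ).trans ?_
    simp only [List.map_const', List.sum_replicate, nsmul_eq_mul]
    have : (β.length : ℝ) ≤ L := by
      exact_mod_cast hL q β (by simpa [mem_offspringSupport, PMF.mem_support_iff] using hβ)
    gcongr
  have h1 : |M.cost q + (β.map Q).sum - Q q| ≤ (C + L * U + U) * (1 + a) := by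
    refine (abs_sub _ _).trans ((add_le_add_left (abs_add_le _ _) _).trans ?_)
    rw [abs_of_pos (M.cost_pos q)]
    have h2 : M.cost q ≤ C := hC ⟨q, rfl⟩
    have h3 := hQ q
    have h4 : C ≤ C * (1 + a) := le_mul_of_one_le_right hC0 (by linarith)
    linarith
  have h5 : |(M.cost q + (β.map Q).sum - Q q) / v q| ≤ (C + L * U + U) * (1 + a) * W := by
    rw [div_eq_mul_inv, abs_mul, abs_of_pos (inv_pos.2 (hv0 q))]
    exact mul_le_mul h1 (hW ⟨q, rfl⟩) (inv_pos.2 (hv0 q)).le (by positivity)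
  have h6 := h q
  linarith

/-- A step of Q-learning decreases the expected relative error if the types are selected with
probabilities bounded from below. -/
theorem exists_offspringMean_relError_le [Fintype T] [DecidableEq T] {v : T → ℝ}
    (hv0 : ∀ q, 0 < v q) (hv : M.target v = v) {pmin : ℝ} (hpmin : 0 < pmin) :
    ∃ (p : ℕ) (ε c K : ℝ), Even p ∧ 0 < ε ∧ 0 ≤ c ∧ 0 ≤ K ∧ c * pmin = 2 * ε ∧
      ∀ (t : ℝ), 0 ≤ t → t ≤ 1 → ∀ (Q : T → ℝ) (q : T),
        M.offspringMean q (fun β => relError v p (M.learn t Q q β)) ≤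
          (1 + t * ε + K * t ^ 2) * relError v p Q + K * t ^ 2 -
            t * c * ((Q q - v q) / v q) ^ p := by
  obtain ⟨γ, hγ0, hγ1, hγ⟩ := exists_contraction_factor M v
  obtain ⟨D, hD0, hD⟩ := exists_abs_increment_le M hv0
  set δ := (1 + γ) / 2 with hδ
  have hδ0 : 0 < δ := by positivity
  have hδ1 : δ < 1 := by linarith
  have hκ : 0 < 1 - γ / δ := by
    rw [sub_pos, div_lt_one hδ0]
    linarith
  obtain ⟨n, hn⟩ := exists_pow_lt_of_lt_one
    -- The exponent is chosen so large that the influence of the other coordinates uses up at most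
    -- half of the decay `(1 - γ / δ) * pmin` secured by the selection probabilities.
    (show 0 < (1 - γ / δ) * pmin / 2 / γ by positivity) hδ1
  set p := 2 * n + 2 with hp
  have hpe : Even p := ⟨n + 1, by omega⟩
  have hδp : γ * δ ^ (2 * n + 1) ≤ (1 - γ / δ) * pmin / 2 := by
    have h1 : δ ^ (2 * n + 1) ≤ δ ^ n := pow_le_pow_of_le_one hδ0.le hδ1.le (by omega)
    have h2 := (lt_div_iff₀ hγ0).1 (h1.trans_lt hn)
    linarith
  -- The last constant combines the remainder bound `p²`, the factor `D ^ p` and the convexity bound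
  -- `(1 + a) ^ p ≤ 2 ^ (p - 1) * (1 + a ^ p)`.
  refine ⟨p, p * ((1 - γ / δ) * pmin / 2), p * (1 - γ / δ), p ^ 2 * (D ^ p * 2 ^ (p - 1)), hpe,
    by positivity, by positivity, by positivity, by ring, fun t ht0 ht1 Q q => ?_⟩
  have : Nonempty T := ⟨q⟩
  obtain ⟨qm, hqm⟩ := Finite.exists_max fun q => |(Q q - v q) / v q|
  set a := |(Q qm - v qm) / v qm| with ha
  have ha0 : 0 ≤ a := abs_nonneg _
  have haV : a ^ p ≤ relError v p Q := by
    rw [ha, hpe.pow_abs]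
    exact pow_le_relError v hpe Q qm
  set V := relError v p Q with hV
  have hV0 : 0 ≤ V := relError_nonneg v hpe Q
  set u := (Q q - v q) / v q with hu
  set h : List T → ℝ := fun β => (M.cost q + (β.map Q).sum - Q q) / v q with hh
  have hvq := hv0 q
  have hlearn : ∀ β, relError v p (M.learn t Q q β) = V + ((u + t * h β) ^ p - u ^ p) := by
    intro β
    rw [learn, relError_update]
    congr 3
    simp only [hu, hh]
    field_simp
    ring
  have hstep : ∀ β ∈ M.offspringSupport q, relError v p (M.learn t Q q β) ≤
      (V + p ^ 2 * (D ^ p * 2 ^ (p - 1)) * t ^ 2 * (1 + V)) + p * t * u ^ (p - 1) * h β := by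
    intro β hβ
    have h1 := (abs_le.1 (abs_add_mul_pow_sub_le (u := u) (h := h β) ht0 ht1 p)).2
    have h2 : (|u| + |h β|) ^ p ≤ D ^ p * 2 ^ (p - 1) * (1 + V) := by
      calc (|u| + |h β|) ^ p ≤ (D * (1 + a)) ^ p := by
            gcongr
            exact hD Q a ha0 hqm q β hβ
        _ = D ^ p * (1 + a) ^ p := mul_pow _ _ _
        _ ≤ D ^ p * (2 ^ (p - 1) * (1 ^ p + a ^ p)) := by
            gcongr
            exact add_pow_le zero_le_one ha0 p
        _ ≤ D ^ p * (2 ^ (p - 1) * (1 + V)) := by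
            gcongr
            exact (one_pow p).le
        _ = _ := by ring
    have h3 : (p : ℝ) ^ 2 * t ^ 2 * (|u| + |h β|) ^ p ≤
        p ^ 2 * t ^ 2 * (D ^ p * 2 ^ (p - 1) * (1 + V)) := by gcongr
    rw [hlearn]
    linarith
  -- The noise has mean zero: on average the relative error `u` moves towards `m`, which the
  -- contraction bounds by `γ a`.
  have hmean : M.offspringMean q h =
      (M.offspringMean q fun β => (β.map fun x => Q x - v x).sum) / v q - u := by
    have h1 := target_sub (M := M) Q v q
    rw [← h1, hv, target_eq]
    have h2 : h = fun β => (v q)⁻¹ * ((M.cost q - Q q) + (β.map Q).sum) := by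
      funext β
      simp only [hh]
      rw [div_eq_inv_mul]
      ring
    rw [h2, offspringMean_const_mul, offspringMean_add, offspringMean_const, hu]
    field_simp
    ring
  set m := (M.offspringMean q fun β => (β.map fun x => Q x - v x).sum) / v q with hm
  have hm' : |m| ≤ γ * a := by
    rw [hm, abs_div, abs_of_pos hvq, div_le_iff₀ hvq]
    have h1 : ∀ q, |Q q - v q| ≤ a * v q := fun q => by
      have := hqm q
      simp only [abs_div, abs_of_pos (hv0 q)] at this
      exact (div_le_iff₀ (hv0 q)).1 this
    refine (abs_offspringMean_sum_le hv h1 q).trans ?_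
    calc a * (v q - M.cost q) ≤ a * (γ * v q) := mul_le_mul_of_nonneg_left (hγ q) ha0
      _ = _ := by ring
  have hdrift : u ^ (p - 1) * m ≤ γ / δ * u ^ p + (1 - γ / δ) * pmin / 2 * V := by
    calc u ^ (p - 1) * m ≤ |u| ^ (p - 1) * |m| := by
          rw [← abs_pow, ← abs_mul]
          exact le_abs_self _
      _ ≤ |u| ^ (p - 1) * (γ * a) := by gcongr
      _ ≤ γ / δ * |u| ^ (p - 1 + 1) + γ * δ ^ (p - 1) * a ^ (p - 1 + 1) :=
          pow_mul_sub_le (abs_nonneg u) hγ0.le hδ0 ha0 _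
      _ = γ / δ * u ^ p + γ * δ ^ (2 * n + 1) * a ^ p := by
          rw [show p - 1 = 2 * n + 1 from rfl, show 2 * n + 1 + 1 = p from rfl, hpe.pow_abs]
      _ ≤ _ := by gcongr
  refine (M.offspringMean_mono hstep).trans ?_
  rw [offspringMean_add, offspringMean_const, offspringMean_const_mul, hmean]
  have h4 : u ^ (p - 1) * u = u ^ p := pow_sub_one_mul (by omega) u
  have h5 : p * t * u ^ (p - 1) * (m - u) = p * t * (u ^ (p - 1) * m - u ^ p) := by
    rw [← h4]; ring
  rw [h5]
  have h6 : p * t * (u ^ (p - 1) * m - u ^ p) ≤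
      p * t * (γ / δ * u ^ p + (1 - γ / δ) * pmin / 2 * V - u ^ p) := by gcongr
  linarith

end BranchingMarkovChain

/-! ### Recursive inequalities with summable perturbations -/

theorem exp_neg_add_mul_le {x y d r s m : ℝ} (hx : 0 ≤ x) (hr : 0 ≤ r) (hs : 0 ≤ s) (hm : 0 ≤ m)
    (h : y ≤ (1 + r) * x - d + r * m) :
    Real.exp (-(s + r)) * y ≤ Real.exp (-s) * x - Real.exp (-(s + r)) * d + r * m := by
  have h0 := Real.exp_pos (-(s + r))
  have h1 : Real.exp (-(s + r)) ≤ 1 := by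
    rw [Real.exp_le_one_iff]
    linarith
  -- The discount absorbs the growth factor, as `1 + r ≤ exp r`.
  have h2 : Real.exp (-(s + r)) * (1 + r) ≤ Real.exp (-s) := by
    have h3 : Real.exp (-s) = Real.exp (-(s + r)) * Real.exp r := by
      rw [← Real.exp_add]
      congr 1
      ring
    rw [h3]
    gcongr
    linarith [Real.add_one_le_exp r]
  have h4 := mul_le_mul_of_nonneg_left h h0.le
  have h5 := mul_le_mul_of_nonneg_right h2 hx
  have h6 := mul_le_mul_of_nonneg_right h1 (mul_nonneg hr hm)
  linarith

section Recursion

variable {lam r : ℕ → ℝ} {ε : ℝ}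

/-- Discounting by `exp (-S n)` and adding the remaining perturbation makes the sequence decreasing,
so `a` converges and `∑ lam n * a n` is finite. A positive limit would make `lam` summable. -/
theorem tendsto_zero_of_recursive_le {a : ℕ → ℝ} (ha : ∀ n, 0 ≤ a n) (hlam : ∀ n, 0 ≤ lam n)
    (hsum : Tendsto (fun n => ∑ i ∈ Finset.range n, lam i) atTop atTop) (hr : ∀ n, 0 ≤ r n)
    (hrs : Summable r) (hε : 0 < ε)
    (h : ∀ n, a (n + 1) ≤ (1 - ε * lam n + r n) * a n + r n) : Tendsto a atTop (𝓝 0) := by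
  set S : ℕ → ℝ := fun n => ∑ i ∈ Finset.range n, r i with hS
  have hS0 : ∀ n, 0 ≤ S n := fun n => Finset.sum_nonneg fun i _ => hr i
  have hSle : ∀ n, S n ≤ ∑' i, r i := fun n => hrs.sum_le_tsum _ fun i _ => hr i
  have hSlim : Tendsto S atTop (𝓝 (∑' i, r i)) := hrs.hasSum.tendsto_sum_nat
  have hSs : ∀ n, S (n + 1) = S n + r n := fun n => Finset.sum_range_succ _ _
  set b : ℕ → ℝ := fun n => Real.exp (-S n) * a n + (∑' i, r i - S n) with hb
  have hb0 : ∀ n, 0 ≤ b n := fun n =>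
    add_nonneg (mul_nonneg (Real.exp_pos _).le (ha n)) (sub_nonneg.2 (hSle n))
  set κ := ε * Real.exp (-∑' i, r i) with hκ
  have hκ0 : 0 < κ := mul_pos hε (Real.exp_pos _)
  have hbs : ∀ n, b (n + 1) + κ * (lam n * a n) ≤ b n := by
    intro n
    have h1 := exp_neg_add_mul_le (y := a (n + 1)) (d := ε * lam n * a n) (m := 1) (ha n) (hr n)
      (hS0 n) zero_le_one (by linarith [h n])
    have h2 : Real.exp (-∑' i, r i) * (ε * lam n * a n) ≤
        Real.exp (-(S n + r n)) * (ε * lam n * a n) := by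
      have h3 := hSle (n + 1)
      rw [hSs] at h3
      have := mul_nonneg (mul_nonneg hε.le (hlam n)) (ha n)
      gcongr
    simp only [hb, hSs, hκ]
    linarith
  have hanti : Antitone b := antitone_nat_of_succ_le fun n => by
    have := mul_nonneg hκ0.le (mul_nonneg (hlam n) (ha n))
    linarith [hbs n]
  have hblim := tendsto_atTop_ciInf hanti ⟨0, by rintro _ ⟨n, rfl⟩; exact hb0 n⟩
  have halim : Tendsto a atTop (𝓝 (Real.exp (∑' i, r i) *
      ((⨅ n, b n) - (∑' i, r i - ∑' i, r i)))) := by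
    have h1 : a = fun n => Real.exp (S n) * (b n - (∑' i, r i - S n)) := by
      funext n
      simp only [hb]
      rw [add_sub_cancel_right, ← mul_assoc, ← Real.exp_add, add_neg_cancel, Real.exp_zero, one_mul]
    rw [h1]
    exact ((Real.continuous_exp.tendsto _).comp hSlim).mul
      (hblim.sub (tendsto_const_nhds.sub hSlim))
  set l := Real.exp (∑' i, r i) * ((⨅ n, b n) - (∑' i, r i - ∑' i, r i))
  have hl0 : 0 ≤ l := ge_of_tendsto' halim ha
  rcases hl0.eq_or_lt with hl | hl
  · rwa [hl]
  exfalso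
  have hsummable : Summable fun n => κ * (lam n * a n) := by
    refine summable_of_sum_range_le (c := b 0)
      (fun n => mul_nonneg hκ0.le (mul_nonneg (hlam n) (ha n))) fun n => ?_
    have h1 : ∑ i ∈ Finset.range n, κ * (lam i * a i) ≤ b 0 - b n := by
      rw [← Finset.sum_range_sub']
      exact Finset.sum_le_sum fun i _ => by linarith [hbs i]
    linarith [hb0 n]
  have hlams : Summable lam := by
    refine Summable.of_norm_bounded_eventually_nat (hsummable.mul_left (2 / (l * κ))) ?_
    filter_upwards [halim.eventually (eventually_ge_nhds (show l / 2 < l by linarith))] with n hn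
    rw [Real.norm_of_nonneg (hlam n)]
    have h1 : lam n * (l / 2) ≤ lam n * a n := mul_le_mul_of_nonneg_left hn (hlam n)
    calc lam n = 2 / l * (lam n * (l / 2)) := by field_simp
      _ ≤ 2 / l * (lam n * a n) := by gcongr
      _ = _ := by field_simp
  exact not_tendsto_atTop_of_tendsto_nhds hlams.hasSum.tendsto_sum_nat hsum

/-- A nonnegative adapted process that, up to summable perturbations, decreases in conditional
expectation by factors with diverging sum of rates, converges to zero. -/
theorem ae_tendsto_zero_of_setIntegral_le {Ω : Type*} {mΩ : MeasurableSpace Ω} {μ : Measure Ω}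
    [IsProbabilityMeasure μ] {ℱ : Filtration ℕ mΩ} {V : ℕ → Ω → ℝ} (hV0 : ∀ n ω, 0 ≤ V n ω)
    (hVm : ∀ n, StronglyMeasurable[ℱ n] (V n)) (hVi : ∀ n, Integrable (V n) μ)
    (hlam : ∀ n, 0 ≤ lam n)
    (hsum : Tendsto (fun n => ∑ i ∈ Finset.range n, lam i) atTop atTop) (hr : ∀ n, 0 ≤ r n)
    (hrs : Summable r) (hε : 0 < ε)
    (h : ∀ n A, MeasurableSet[ℱ n] A → ∫ ω in A, V (n + 1) ω ∂μ ≤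
      (1 - ε * lam n + r n) * ∫ ω in A, V n ω ∂μ + r n * μ.real A) :
    ∀ᵐ ω ∂μ, Tendsto (fun n => V n ω) atTop (𝓝 0) := by
  have hmean : Tendsto (fun n => ∫ ω, V n ω ∂μ) atTop (𝓝 0) := by
    refine tendsto_zero_of_recursive_le (fun n => integral_nonneg (hV0 n)) hlam hsum hr hrs hε
      fun n => ?_
    simpa using h n Set.univ MeasurableSet.univ
  set S : ℕ → ℝ := fun n => ∑ i ∈ Finset.range n, r i with hS
  have hS0 : ∀ n, 0 ≤ S n := fun n => Finset.sum_nonneg fun i _ => hr i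
  have hSle : ∀ n, S n ≤ ∑' i, r i := fun n => hrs.sum_le_tsum _ fun i _ => hr i
  have hSlim : Tendsto S atTop (𝓝 (∑' i, r i)) := hrs.hasSum.tendsto_sum_nat
  have hSs : ∀ n, S (n + 1) = S n + r n := fun n => Finset.sum_range_succ _ _
  set U : ℕ → Ω → ℝ := fun n ω => Real.exp (-S n) * V n ω + (∑' i, r i - S n) with hU
  have hU0 : ∀ n ω, 0 ≤ U n ω := fun n ω =>
    add_nonneg (mul_nonneg (Real.exp_pos _).le (hV0 n ω)) (sub_nonneg.2 (hSle n))
  have hUi : ∀ n, Integrable (U n) μ := fun n => ((hVi n).const_mul _).add (integrable_const _)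
  have hsuper : Supermartingale U ℱ μ := by
    refine supermartingale_of_setIntegral_succ_le (fun n => ?_) hUi fun n A hA => ?_
    · exact ((hVm n).const_mul _).add stronglyMeasurable_const
    · have e : ∀ k, ∫ ω in A, U k ω ∂μ =
          Real.exp (-S k) * ∫ ω in A, V k ω ∂μ + (∑' i, r i - S k) * μ.real A := by
        intro k
        simp only [hU]
        rw [integral_add ((hVi k).const_mul _).integrableOn (integrable_const _),
          integral_const_mul, setIntegral_const, smul_eq_mul, mul_comm (μ.real A)]
      have hVA : 0 ≤ ∫ ω in A, V n ω ∂μ := integral_nonneg (hV0 n)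
      have h1 := exp_neg_add_mul_le (y := ∫ ω in A, V (n + 1) ω ∂μ)
        (d := ε * lam n * ∫ ω in A, V n ω ∂μ) (m := μ.real A) hVA (hr n) (hS0 n)
        measureReal_nonneg (by linarith [h n A hA])
      have h2 : 0 ≤ Real.exp (-(S n + r n)) * (ε * lam n * ∫ ω in A, V n ω ∂μ) :=
        mul_nonneg (Real.exp_pos _).le (mul_nonneg (mul_nonneg hε.le (hlam n)) hVA)
      rw [e, e, hSs]
      linarith
  have hbdd : ∀ n, eLpNorm ((-U) n) 1 μ ≤ (∫ ω, U 0 ω ∂μ).toNNReal := by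
    intro n
    rw [Pi.neg_apply, eLpNorm_neg, eLpNorm_one_eq_lintegral_enorm,
      ← ofReal_integral_norm_eq_lintegral_enorm (hUi n)]
    simp only [Real.norm_of_nonneg (hU0 n _)]
    refine ENNReal.ofReal_le_ofReal ?_
    simpa using hsuper.setIntegral_le (Nat.zero_le n) (MeasurableSet.univ (α := Ω))
  -- The nonnegative supermartingale `U` converges almost surely, hence so does `V`.
  have hlim := hsuper.neg.exists_ae_tendsto_of_bdd hbdd
  -- Fatou's lemma and the vanishing means identify the almost sure limit as `0`.
  have hfatou : ∫⁻ ω, liminf (fun n => ENNReal.ofReal (V n ω)) atTop ∂μ = 0 := by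
    rw [← nonpos_iff_eq_zero]
    refine (lintegral_liminf_le fun n =>
      (((hVm n).mono (ℱ.le n)).measurable).ennreal_ofReal).trans (le_of_eq ?_)
    have h1 : ∀ n, ∫⁻ ω, ENNReal.ofReal (V n ω) ∂μ = ENNReal.ofReal (∫ ω, V n ω ∂μ) := fun n =>
      (ofReal_integral_eq_lintegral_ofReal (hVi n) (ae_of_all _ (hV0 n))).symm
    simp_rw [h1]
    have h2 := (ENNReal.continuous_ofReal.tendsto _).comp hmean
    rw [ENNReal.ofReal_zero] at h2
    exact h2.liminf_eq
  rw [lintegral_eq_zero_iff (Measurable.liminf fun n =>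
      (((hVm n).mono (ℱ.le n)).measurable).ennreal_ofReal)] at hfatou
  filter_upwards [hlim, hfatou] with ω ⟨c, hc⟩ h0
  have hVlim : Tendsto (fun n => V n ω) atTop (𝓝 (Real.exp (∑' i, r i) *
      (-c - (∑' i, r i - ∑' i, r i)))) := by
    have h1 : (fun n => V n ω) =
        fun n => Real.exp (S n) * (-(-U) n ω - (∑' i, r i - S n)) := by
      funext n
      simp only [hU, Pi.neg_apply, neg_neg]
      rw [add_sub_cancel_right, ← mul_assoc, ← Real.exp_add, add_neg_cancel, Real.exp_zero, one_mul]
    rw [h1]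
    exact ((Real.continuous_exp.tendsto _).comp hSlim).mul
      (hc.neg.sub (tendsto_const_nhds.sub hSlim))
  set l := Real.exp (∑' i, r i) * (-c - (∑' i, r i - ∑' i, r i))
  have h2 := ((ENNReal.continuous_ofReal.tendsto _).comp hVlim).liminf_eq
  simp only [Function.comp_def] at h2
  rw [h2, Pi.zero_apply, ENNReal.ofReal_eq_zero] at h0
  have hl : l = 0 := le_antisymm h0 (ge_of_tendsto' hVlim fun n => hV0 n ω)
  rwa [hl] at hVlim

end Recursion

/-! ### Q-learning as an adapted process -/

namespace BranchingMarkovChain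

variable {T : Type*} {M : BranchingMarkovChain T}

theorem continuous_learn [DecidableEq T] (M : BranchingMarkovChain T) (t : ℝ) (q : T)
    (β : List T) : Continuous fun Q : T → ℝ => M.learn t Q q β := by
  have h : Continuous fun Q : T → ℝ => (β.map Q).sum := by
    induction β with
    | nil => simpa using continuous_const
    | cons a l ih =>
      simp only [List.map_cons, List.sum_cons]
      fun_prop
  unfold learn
  fun_prop

theorem continuous_relError [Fintype T] (v : T → ℝ) (p : ℕ) : Continuous (relError v p) := by
  unfold relError
  fun_prop

namespace IsLearningSample

variable {Ω : Type*} {mΩ : MeasurableSpace Ω} {μ : Measure Ω} {ℱ : Filtration ℕ mΩ} {pmin : ℝ}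
  {sel : ℕ → Ω → T} {spawn : ℕ → Ω → List T}

theorem measurableSet_sel (hs : M.IsLearningSample μ ℱ pmin sel spawn) (n : ℕ) (q : T) :
    MeasurableSet {ω | sel n ω = q} := ℱ.le _ _ (hs.measurable_sel n q)

theorem measurableSet_spawn (hs : M.IsLearningSample μ ℱ pmin sel spawn) (n : ℕ) (β : List T) :
    MeasurableSet {ω | spawn n ω = β} := ℱ.le _ _ (hs.measurable_spawn n β)

theorem ae_spawn_mem [Countable T] (hs : M.IsLearningSample μ ℱ pmin sel spawn) (n : ℕ) :
    ∀ᵐ ω ∂μ, spawn n ω ∈ M.offspringSupport (sel n ω) := by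
  have h : ∀ q β, β ∉ M.offspringSupport q → ∀ᵐ ω ∂μ, ¬(sel n ω = q ∧ spawn n ω = β) := by
    intro q β hβ
    have h1 := hs.measure_spawn n q β Set.univ MeasurableSet.univ
    rw [not_not.1 (fun h0 => hβ (M.mem_offspringSupport.2 h0)), mul_zero, Set.univ_inter] at h1
    rw [ae_iff]
    simp only [not_not]
    exact h1
  have h2 : ∀ᵐ ω ∂μ, ∀ q β, β ∉ M.offspringSupport q → ¬(sel n ω = q ∧ spawn n ω = β) := by
    rw [ae_all_iff]
    intro q
    rw [ae_all_iff]
    intro β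
    by_cases hβ : β ∈ M.offspringSupport q
    · exact ae_of_all _ fun ω h0 => absurd hβ h0
    · filter_upwards [h q β hβ] with ω hω _
      exact hω
  filter_upwards [h2] with ω hω
  by_contra hc
  exact hω _ _ hc ⟨rfl, rfl⟩

/-- The sampling law says that two measures, restricted to the σ-algebra `ℱ n`, agree up to the
factor `offspring q β`; hence so do integrals of `ℱ n`-measurable functions. -/
theorem setIntegral_spawn (hs : M.IsLearningSample μ ℱ pmin sel spawn) (n : ℕ) (q : T)
    (β : List T) {A : Set Ω} (hA : MeasurableSet[ℱ n] A) {g : Ω → ℝ}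
    (hg : StronglyMeasurable[ℱ n] g) :
    ∫ ω in A ∩ {ω | sel n ω = q} ∩ {ω | spawn n ω = β}, g ω ∂μ =
      (M.offspring q β).toReal * ∫ ω in A ∩ {ω | sel n ω = q}, g ω ∂μ := by
  rw [← smul_eq_mul, ← integral_smul_measure, integral_trim (ℱ.le n) hg,
    integral_trim (ℱ.le n) hg]
  congr 1
  refine @Measure.ext _ (ℱ n) _ _ fun B hB => ?_
  rw [trim_measurableSet_eq _ hB, trim_measurableSet_eq _ hB, Measure.smul_apply,
    Measure.restrict_apply (ℱ.le n _ hB), Measure.restrict_apply (ℱ.le n _ hB),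
    ← Set.inter_assoc, ← Set.inter_assoc, hs.measure_spawn n q β _ (hB.inter hA), smul_eq_mul,
    mul_comm]

theorem mul_setIntegral_le (hs : M.IsLearningSample μ ℱ pmin sel spawn) (hpmin : 0 ≤ pmin) (n : ℕ)
    (q : T) {A : Set Ω} (hA : MeasurableSet[ℱ n] A) {g : Ω → ℝ} (hg : StronglyMeasurable[ℱ n] g)
    (hg0 : ∀ ω, 0 ≤ g ω) (hgi : Integrable g μ) :
    pmin * ∫ ω in A, g ω ∂μ ≤ ∫ ω in A ∩ {ω | sel n ω = q}, g ω ∂μ := by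
  have h : (ENNReal.ofReal pmin • (μ.restrict A)).trim (ℱ.le n) ≤
      (μ.restrict (A ∩ {ω | sel n ω = q})).trim (ℱ.le n) := by
    refine Measure.le_iff.2 fun B hB => ?_
    rw [trim_measurableSet_eq _ hB, trim_measurableSet_eq _ hB, Measure.smul_apply,
      Measure.restrict_apply (ℱ.le n _ hB), Measure.restrict_apply (ℱ.le n _ hB),
      ← Set.inter_assoc, smul_eq_mul]
    exact hs.le_measure_sel n q _ (hB.inter hA)
  calc pmin * ∫ ω in A, g ω ∂μ = ∫ ω, g ω ∂(ENNReal.ofReal pmin • (μ.restrict A)) := by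
        rw [integral_smul_measure, ENNReal.toReal_ofReal hpmin, smul_eq_mul]
    _ = ∫ ω, g ω ∂(ENNReal.ofReal pmin • (μ.restrict A)).trim (ℱ.le n) :=
        integral_trim (ℱ.le n) hg
    _ ≤ ∫ ω, g ω ∂(μ.restrict (A ∩ {ω | sel n ω = q})).trim (ℱ.le n) :=
        integral_mono_measure h (ae_of_all _ hg0) (hgi.integrableOn.trim (ℱ.le n) hg)
    _ = _ := (integral_trim (ℱ.le n) hg).symm

/-- Partition by the selected type and the observed offspring, then average out the offspring: a
conditional expectation in integrated form. -/
theorem setIntegral_eq_sum [Fintype T] [DecidableEq T]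
    (hs : M.IsLearningSample μ ℱ pmin sel spawn) (n : ℕ)
    {A : Set Ω} (hA : MeasurableSet[ℱ n] A) {G : T → List T → Ω → ℝ}
    (hG : ∀ q β, StronglyMeasurable[ℱ n] (G q β)) (hGi : ∀ q β, Integrable (G q β) μ) :
    ∫ ω in A, G (sel n ω) (spawn n ω) ω ∂μ =
      ∑ q, ∫ ω in A ∩ {ω | sel n ω = q}, M.offspringMean q (fun β => G q β ω) ∂μ := by
  have hm : ∀ q β, MeasurableSet ({ω | sel n ω = q} ∩ {ω | spawn n ω = β}) := fun q β =>
    (hs.measurableSet_sel n q).inter (hs.measurableSet_spawn n β)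
  have h1 : ∫ ω in A, G (sel n ω) (spawn n ω) ω ∂μ = ∫ ω in A, ∑ q, ∑ β ∈ M.offspringSupport q,
      ({ω | sel n ω = q} ∩ {ω | spawn n ω = β}).indicator (G q β) ω ∂μ := by
    refine integral_congr_ae (ae_restrict_of_ae ?_)
    filter_upwards [hs.ae_spawn_mem n] with ω hω
    refine Eq.symm ((Finset.sum_eq_single (sel n ω) (fun q _ hq => ?_) (by simp)).trans
      ((Finset.sum_eq_single (spawn n ω) (fun β _ hβ => ?_) (fun h => absurd hω h)).trans ?_))
    · refine Finset.sum_eq_zero fun β _ => Set.indicator_of_notMem ?_ _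
      exact fun h => hq h.1.symm
    · refine Set.indicator_of_notMem ?_ _
      exact fun h => hβ h.2.symm
    · have hmem : ω ∈ {ω' | sel n ω' = sel n ω} ∩ {ω' | spawn n ω' = spawn n ω} := ⟨rfl, rfl⟩
      exact Set.indicator_of_mem hmem (G (sel n ω) (spawn n ω))
  rw [h1, integral_finsetSum _ fun q _ => integrable_finsetSum _ fun β _ =>
    ((hGi q β).indicator (hm q β)).integrableOn]
  refine Finset.sum_congr rfl fun q _ => ?_
  simp only [offspringMean]
  rw [integral_finsetSum _ fun β _ => ((hGi q β).indicator (hm q β)).integrableOn,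
    integral_finsetSum _ fun β _ => ((hGi q β).const_mul _).integrableOn]
  refine Finset.sum_congr rfl fun β _ => ?_
  rw [integral_indicator (hm q β), Measure.restrict_restrict (hm q β), Set.inter_comm _ A,
    ← Set.inter_assoc, hs.setIntegral_spawn n q β hA (hG q β), integral_const_mul]

variable [Fintype T] [DecidableEq T] {lam : ℕ → ℝ} {Q₀ : T → ℝ}

theorem measurable_qValues (hs : M.IsLearningSample μ ℱ pmin sel spawn) (n : ℕ) :
    Measurable[ℱ n]
      fun ω => M.qValues lam Q₀ (fun j => sel j ω) (fun j => spawn j ω) n := by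
  induction n with
  | zero => exact measurable_const
  | succ n ih =>
    let : MeasurableSpace T := ⊤
    let : MeasurableSpace (List T) := ⊤
    have h1 : Measurable[ℱ (n + 1)] (sel n) :=
      @measurable_to_countable' _ _ _ _ (ℱ (n + 1)) _ fun q => hs.measurable_sel n q
    have h2 : Measurable[ℱ (n + 1)] (spawn n) :=
      @measurable_to_countable' _ _ _ _ (ℱ (n + 1)) _ fun β => hs.measurable_spawn n β
    have h3 : Measurable[ℱ (n + 1)]
        fun ω => M.qValues lam Q₀ (fun j => sel j ω) (fun j => spawn j ω) n :=
      ih.mono (ℱ.mono (Nat.le_succ n)) le_rfl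
    have h4 : Measurable fun x : (T × List T) × (T → ℝ) => M.learn (lam n) x.2 x.1.1 x.1.2 :=
      measurable_from_prod_countable_right fun x =>
        (M.continuous_learn (lam n) x.1 x.2).measurable
    exact h4.comp ((h1.prodMk h2).prodMk h3)

/-- Almost surely one of finitely many continuous maps is applied, so bounded sets stay bounded. The
bound may depend on `n` and serves only integrability. -/
theorem exists_norm_qValues_le (hs : M.IsLearningSample μ ℱ pmin sel spawn) (n : ℕ) :
    ∃ C, ∀ᵐ ω ∂μ, ‖M.qValues lam Q₀ (fun j => sel j ω) (fun j => spawn j ω) n‖ ≤ C := by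
  induction n with
  | zero => exact ⟨‖Q₀‖, ae_of_all _ fun _ => le_rfl⟩
  | succ n ih =>
    obtain ⟨C, hC⟩ := ih
    have hK : IsCompact (⋃ q, ⋃ β ∈ M.offspringSupport q,
        (fun Q : T → ℝ => M.learn (lam n) Q q β) '' Metric.closedBall 0 C) :=
      isCompact_iUnion fun q => (M.offspringSupport q).isCompact_biUnion fun β _ =>
        (isCompact_closedBall 0 C).image (M.continuous_learn (lam n) q β)
    obtain ⟨C', hC'⟩ := hK.isBounded.exists_norm_le
    refine ⟨C', ?_⟩
    filter_upwards [hC, hs.ae_spawn_mem n] with ω h1 h2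
    exact hC' _ (Set.mem_iUnion.2 ⟨sel n ω, Set.mem_iUnion₂.2 ⟨spawn n ω, h2,
      Set.mem_image_of_mem _ (mem_closedBall_zero_iff.2 h1)⟩⟩)

theorem stronglyMeasurable_comp_qValues (hs : M.IsLearningSample μ ℱ pmin sel spawn) (n : ℕ)
    {g : (T → ℝ) → ℝ} (hg : Continuous g) : StronglyMeasurable[ℱ n]
      fun ω => g (M.qValues lam Q₀ (fun j => sel j ω) (fun j => spawn j ω) n) :=
  (hg.measurable.comp (hs.measurable_qValues n)).stronglyMeasurable

theorem integrable_comp_qValues [IsFiniteMeasure μ]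
    (hs : M.IsLearningSample μ ℱ pmin sel spawn) (n : ℕ)
    {g : (T → ℝ) → ℝ} (hg : Continuous g) : Integrable
      (fun ω => g (M.qValues lam Q₀ (fun j => sel j ω) (fun j => spawn j ω) n)) μ := by
  obtain ⟨C, hC⟩ := hs.exists_norm_qValues_le (lam := lam) (Q₀ := Q₀) n
  obtain ⟨D, hD⟩ := (isCompact_closedBall (0 : T → ℝ) C).exists_bound_of_continuousOn
    hg.continuousOn
  refine Integrable.of_bound
    ((hs.stronglyMeasurable_comp_qValues n hg).mono (ℱ.le n)).aestronglyMeasurable D ?_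
  filter_upwards [hC] with ω h
  exact hD _ (mem_closedBall_zero_iff.2 h)

/-- The decay of the selected coordinate, weighted with its selection probability, sums over the
types to at least `lam n * c * pmin = 2 * ε * lam n` times `V`; this beats the growth `ε * lam n`.
-/
theorem setIntegral_relError_le [IsFiniteMeasure μ]
    (hs : M.IsLearningSample μ ℱ pmin sel spawn) (hpmin : 0 ≤ pmin) {v : T → ℝ} {p : ℕ}
    (hp : Even p) {ε c K : ℝ} (hc : 0 ≤ c) (hcε : c * pmin = 2 * ε) (n : ℕ)
    (hlam : 0 ≤ lam n)
    (h : ∀ (Q : T → ℝ) (q : T), M.offspringMean q (fun β => relError v p (M.learn (lam n) Q q β)) ≤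
      (1 + lam n * ε + K * lam n ^ 2) * relError v p Q + K * lam n ^ 2 -
        lam n * c * ((Q q - v q) / v q) ^ p)
    {A : Set Ω} (hA : MeasurableSet[ℱ n] A) :
    ∫ ω in A, relError v p
        (M.qValues lam Q₀ (fun j => sel j ω) (fun j => spawn j ω) (n + 1)) ∂μ ≤
      (1 - ε * lam n + K * lam n ^ 2) * ∫ ω in A, relError v p
        (M.qValues lam Q₀ (fun j => sel j ω) (fun j => spawn j ω) n) ∂μ +
        K * lam n ^ 2 * μ.real A := by
  set Q : Ω → T → ℝ := fun ω => M.qValues lam Q₀ (fun j => sel j ω) (fun j => spawn j ω) n with hQ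
  have hm : ∀ {g : (T → ℝ) → ℝ}, Continuous g → StronglyMeasurable[ℱ n] fun ω => g (Q ω) :=
    fun hg => hs.stronglyMeasurable_comp_qValues n hg
  have hi : ∀ {g : (T → ℝ) → ℝ}, Continuous g → Integrable (fun ω => g (Q ω)) μ :=
    fun hg => hs.integrable_comp_qValues n hg
  have hcl : ∀ q β, Continuous fun R : T → ℝ => relError v p (M.learn (lam n) R q β) :=
    fun q β => (continuous_relError v p).comp (M.continuous_learn (lam n) q β)
  have hcu : ∀ q, Continuous fun R : T → ℝ => ((R q - v q) / v q) ^ p := fun q => by fun_prop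
  have hcm : ∀ q, Continuous fun R : T → ℝ =>
      M.offspringMean q fun β => relError v p (M.learn (lam n) R q β) := fun q =>
    continuous_finsetSum _ fun β _ => continuous_const.mul (hcl q β)
  set f : (T → ℝ) → ℝ := fun R =>
    (1 + lam n * ε + K * lam n ^ 2) * relError v p R + K * lam n ^ 2 with hf
  have hcf : Continuous f := (continuous_const.mul (continuous_relError v p)).add continuous_const
  have h1 := hs.setIntegral_eq_sum n hA (G := fun q β ω => relError v p (M.learn (lam n) (Q ω) q β))
    (fun q β => hm (hcl q β)) (fun q β => hi (hcl q β))
  -- An integrand independent of selection and offspring reassembles the pieces over the selected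
  -- types into an integral over `A`.
  have h2 := hs.setIntegral_eq_sum n hA (G := fun _ _ ω => f (Q ω))
    (fun _ _ => hm hcf) (fun _ _ => hi hcf)
  simp only [offspringMean_const] at h2
  have h3 : ∀ q, ∫ ω in A ∩ {ω | sel n ω = q},
        M.offspringMean q (fun β => relError v p (M.learn (lam n) (Q ω) q β)) ∂μ ≤
      ∫ ω in A ∩ {ω | sel n ω = q}, f (Q ω) ∂μ -
        lam n * c * (pmin * ∫ ω in A, ((Q ω q - v q) / v q) ^ p ∂μ) := by
    intro q
    have h4 := hs.mul_setIntegral_le hpmin n q hA (hm (hcu q)) (fun ω => hp.pow_nonneg _)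
      (hi (hcu q))
    calc _ ≤ ∫ ω in A ∩ {ω | sel n ω = q},
          (f (Q ω) - lam n * c * ((Q ω q - v q) / v q) ^ p) ∂μ :=
          integral_mono (hi (hcm q)).integrableOn
            ((hi hcf).sub ((hi (hcu q)).const_mul _)).integrableOn fun ω => h (Q ω) q
      _ = ∫ ω in A ∩ {ω | sel n ω = q}, f (Q ω) ∂μ -
          lam n * c * ∫ ω in A ∩ {ω | sel n ω = q}, ((Q ω q - v q) / v q) ^ p ∂μ := by
          rw [integral_sub (hi hcf).integrableOn ((hi (hcu q)).const_mul _).integrableOn,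
            integral_const_mul]
      _ ≤ _ := by gcongr
  have h5 : ∑ q, ∫ ω in A, ((Q ω q - v q) / v q) ^ p ∂μ = ∫ ω in A, relError v p (Q ω) ∂μ := by
    simp only [relError]
    rw [integral_finsetSum _ fun q _ => (hi (hcu q)).integrableOn]
  have h6 : ∫ ω in A, f (Q ω) ∂μ = (1 + lam n * ε + K * lam n ^ 2) *
      ∫ ω in A, relError v p (Q ω) ∂μ + K * lam n ^ 2 * μ.real A := by
    simp only [hf]
    rw [integral_add ((hi (continuous_relError v p)).const_mul _).integrableOn
      (integrable_const _), integral_const_mul, setIntegral_const, smul_eq_mul,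
      mul_comm (μ.real A)]
  calc _ = ∑ q, ∫ ω in A ∩ {ω | sel n ω = q},
        M.offspringMean q (fun β => relError v p (M.learn (lam n) (Q ω) q β)) ∂μ := h1
    _ ≤ ∑ q, (∫ ω in A ∩ {ω | sel n ω = q}, f (Q ω) ∂μ -
        lam n * c * (pmin * ∫ ω in A, ((Q ω q - v q) / v q) ^ p ∂μ)) :=
        Finset.sum_le_sum fun q _ => h3 q
    _ = ∫ ω in A, f (Q ω) ∂μ - lam n * (c * pmin) * ∫ ω in A, relError v p (Q ω) ∂μ := by
        rw [Finset.sum_sub_distrib, ← h2, ← Finset.mul_sum, ← Finset.mul_sum, h5]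
        ring
    _ = _ := by
        rw [hcε, h6]
        ring

end IsLearningSample

end BranchingMarkovChain

/-! ### Convergence of the Q-values -/

namespace BranchingMarkovChain

theorem tendsto_of_relError {T : Type*} [Fintype T] {v : T → ℝ} (hv0 : ∀ q, 0 < v q) {p : ℕ}
    (hp : Even p) {Q : ℕ → T → ℝ}
    (h : Tendsto (fun n => relError v p (Q n)) atTop (𝓝 0)) : Tendsto Q atTop (𝓝 v) := by
  refine tendsto_pi_nhds.2 fun q => ?_
  have h1 : Tendsto (fun n => (Q n q - v q) / v q) atTop (𝓝 0) := by
    rw [Metric.tendsto_atTop] at h ⊢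
    intro ε hε
    obtain ⟨N, hN⟩ := h (ε ^ p) (by positivity)
    refine ⟨N, fun n hn => ?_⟩
    have h2 := hN n hn
    rw [Real.dist_0_eq_abs, abs_of_nonneg (relError_nonneg v hp _)] at h2
    rw [Real.dist_0_eq_abs]
    refine lt_of_pow_lt_pow_left₀ p hε.le ?_
    rw [hp.pow_abs]
    exact (pow_le_relError v hp _ q).trans_lt h2
  have h3 : (fun n => Q n q) = fun n => v q + v q * ((Q n q - v q) / v q) := by
    funext n
    field_simp [(hv0 q).ne']
    ring
  rw [h3]
  simpa using (h1.const_mul (v q)).const_add (v q)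

theorem toReal_cStar_pos {T : Type*} [Finite T] {M : BranchingMarkovChain T}
    (hfin : ∀ q, M.cStar q ≠ ∞) (q : T) : 0 < (M.cStar q).toReal := by
  refine ENNReal.toReal_pos ?_ (hfin q)
  rw [M.cStar_eq q]
  simp [M.cost_pos q]

end BranchingMarkovChain

theorem mainTheorem2 {T : Type*} [Fintype T] [DecidableEq T] (M : BranchingMarkovChain T)
    (hfin : ∀ q, M.cStar q ≠ ∞)
    {Ω : Type*} {mΩ : MeasurableSpace Ω} (μ : Measure Ω) [IsProbabilityMeasure μ]
    (ℱ : Filtration ℕ mΩ) (pmin : ℝ) (hpmin : 0 < pmin)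
    (sel : ℕ → Ω → T) (spawn : ℕ → Ω → List T)
    (hsample : M.IsLearningSample μ ℱ pmin sel spawn)
    (lam : ℕ → ℝ) (hlam : ∀ i, lam i ∈ Set.Icc (0 : ℝ) 1)
    (hsum : Tendsto (fun n => ∑ i ∈ Finset.range n, lam i) atTop atTop)
    (hsq : Summable fun i => lam i ^ 2)
    (Q₀ : T → ℝ) (hQ₀ : ∀ q, 0 ≤ Q₀ q) :
    (∀ᵐ ω ∂μ, Tendsto (fun i => M.qValues lam Q₀ (fun j => sel j ω) (fun j => spawn j ω) i)
      atTop (𝓝 fun q => (M.cStar q).toReal)) ∧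
    (∀ Q : T → ℝ, M.target Q = M.meanMatrix.mulVec Q + M.cost) ∧
    (∀ Q : T → ℝ, M.target Q = Q ↔ Q = fun q => (M.cStar q).toReal) := by
  have hv0 := BranchingMarkovChain.toReal_cStar_pos hfin
  have hv := M.target_toReal_cStar hfin
  refine ⟨?_, M.target_eq_mulVec_add, fun Q =>
    ⟨BranchingMarkovChain.eq_of_target_eq hv0 hv, fun h => h ▸ hv⟩⟩
  obtain ⟨p, ε, c, K, hp, hε, hc, hK, hcε, hstep⟩ :=
    BranchingMarkovChain.exists_offspringMean_relError_le hv0 hv hpmin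
  have hlim := ae_tendsto_zero_of_setIntegral_le (μ := μ) (ℱ := ℱ) (r := fun n => K * lam n ^ 2)
    (fun n ω => BranchingMarkovChain.relError_nonneg _ hp
      (M.qValues lam Q₀ (fun j => sel j ω) (fun j => spawn j ω) n))
    (fun n => hsample.stronglyMeasurable_comp_qValues n
      (BranchingMarkovChain.continuous_relError _ p))
    (fun n => hsample.integrable_comp_qValues n (BranchingMarkovChain.continuous_relError _ p))
    (fun n => (hlam n).1) hsum (fun n => mul_nonneg hK (sq_nonneg _)) (hsq.mul_left K) hε
    fun n A hA => hsample.setIntegral_relError_le hpmin.le hp hc hcε n (hlam n).1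
      (hstep (lam n) (hlam n).1 (hlam n).2) hA
  filter_upwards [hlim] with ω hω
  exact BranchingMarkovChain.tendsto_of_relError hv0 hp hω
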